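/- **Setting.** Let $F:\mathbb R^{3N}\to\mathbb R^{3N}$ be continuous, $A\in\mathbb R^{3N\times 3N}$ symmetric positive definite and $\Gamma\in\mathbb R^{3N\times 3N}$ symmetric positive semidefinite. Let $\Phi\in\mathbb R^{3N\times m}$, $\Psi\in\mathbb R^{3N\times(3N-m)}$ satisfy $\Phi^T\Phi=I$, $\Psi^T\Psi=I$, $\Phi^T\Psi=0$. Put $A_{11}=\Phi^TA\Phi$, $A_{12}=\Phi^TA\Psi$, $A_{21}=\Psi^TA\Phi$, $A_{22}=\Psi^TA\Psi$, define $\Gamma_{11},\dots,\Gamma_{22}$ in the same way, and let $F_{\rm eff}(q)=\Phi^TF(\Phi q)-A_{12}A_{22}^{-1}A_{21}q$. The exact memory kernel is $$\theta(t)=[A_{12}\ \ \Gamma_{12}]\,e^{-Gt}\begin{bmatrix}A_{22}^{-1}&0\\0&-I\end{bmatrix}\begin{bmatrix}A_{21}\\ \Gamma_{21}\end{bmatrix},\qquad G=\begin{bmatrix}0&-I\\A_{22}&\Gamma_{22}\end{bmatrix},$$ and it is assumed to be integrable on $(0,\infty)$. Let $M_\infty=\int_0^\infty\theta(t)\,dt$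 and $\Theta(\lambda)=\int_0^\infty\theta(t)e^{-t/\lambda}\,dt$. **Moment matching.** Let $B_0,B_1,C_0,C_1\in\mathbb R^{m\times m}$ be such that the rational function $R_{2,2}(\lambda)=[I-\lambda B_0-\lambda^2B_1]^{-1}[\lambda C_0+\lambda^2C_1]$ satisfies $\Theta(\lambda)-R_{2,2}(\lambda)=o(\lambda^3)$ as $\lambda\to0^+$ and $\Theta(\lambda)-R_{2,2}(\lambda)\to0$ as $\lambda\to+\infty$. Put $$\widehat B=\begin{bmatrix}0&B_1\\I&B_0\end{bmatrix},\qquad Q=\begin{bmatrix}Q_1&Q_{12}\\Q_{12}^T&Q_2\end{bmatrix},\qquad Q_1=-C_0^TB_1^T-B_0C_1^T,\quad Q_2=C_0,\quad Q_{12}=C_1.$$ **Second-order model.** Let $k_B,T>0$ and consider $$\dot q=p,\quad \dot p=F_{\rm eff}(q)-\Gamma_{11}p-z+f_1,\quad \dot z_1=B_1z+C_1p+\zeta_1,\quad \dot z=z_1+B_0z+C_0p+\zeta.$$ Suppose that $(z_1(0),z(0))$ is a centered Gaussian vector with covariance $k_BT\,Q$, that $(\zeta_1,\zeta)$ is a Gaussian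 white noise whose covariance $\Sigma$ is given by the Lyapunov equation $k_BT(\widehat BQ+Q\widehat B^T)=-\Sigma$, that $f_1$ is a Gaussian white noise with covariance $2k_BT\,\Gamma_{11}$, and that $(z_1(0),z(0))$, $(\zeta_1,\zeta)$ and $f_1$ are independent. (In particular, $Q$ and $\Sigma$ are supposed to be covariance matrices, i.e. symmetric and positive semidefinite.) White noises are understood through their time integrals, which are Wiener processes with almost surely continuous paths, and the equations are understood in time-integrated form, path by path. **Theorem 2.** Let $\theta_2(t)=[0\ \ I]\,e^{t\widehat B}\begin{bmatrix}C_1\\C_0\end{bmatrix}$ and $g(t)=[0\ \ I]\Big(e^{t\widehat B}\begin{bmatrix}z_1(0)\\z(0)\end{bmatrix}+\int_0^te^{(t-s)\widehat B}\begin{bmatrix}\zeta_1(s)\\ \zeta(s)\end{bmatrix}ds\Big)$. Then: 1. $C_0=\theta(0)$, $C_1+B_0C_0=\theta'(0)$, $B_0\theta'(0)+B_1C_0=\theta''(0)$ and $C_1=-B_1M_\infty$. 2. For all sufficiently small $\lambda>0$ the integral $\int_0^\infty\theta_2(t)e^{-t/\lambda}\,dt$ converges absolutely and equals $R_{2,2}(\lambda)$.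 3. Almost surely, the second-order model with the initial values $z_1(0),z(0)$ is equivalent to the generalized Langevin equation $\dot q=p$, $\dot p=F_{\rm eff}(q)-\Gamma_{11}p-\int_0^t\theta_2(t-\tau)p(\tau)\,d\tau+\widehat f$ with $\widehat f=f_1-g$: continuous paths $(q,p)$ solve the latter if and only if they can be completed by continuous paths $(z_1,z)$ to a solution of the former, and then $z(t)=\int_0^t\theta_2(t-\tau)p(\tau)\,d\tau+g(t)$. So $\theta_2$ is the approximate memory kernel. 4. The colored noise $g$ is a centered stationary Gaussian process, and $\langle g(t)g(t')^T\rangle=k_BT\,\theta_2(t-t')$ for $t\ge t'\ge0$. 5. The noise $\widehat f$ is centered Gaussian and satisfies the second fluctuation-dissipation theorem exactly: $\langle\widehat f(t)\widehat f(t')^T\rangle=2k_BT\,\Gamma_{11}\delta(t-t')+k_BT\,\theta_2(t-t')$, where $\theta_2(-t)=\theta_2(t)^T$ for $t>0$; that is, for all $s,t\ge0$ the integrated noise $n(t)=\int_0^t\widehat f$ satisfies $\langle n(s)n(t)^T\rangle=2k_BT\,\Gamma_{11}\min(s,t)+k_BT\int_0^s\!\int_0^t\theta_2(u-v)\,dv\,du$.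 -/

import Mathlib

open MeasureTheory ProbabilityTheory Filter Topology Set
open scoped Matrix NNReal

namespace CoarseGrain

/-- The mass-scaled Langevin model `x'' = F(x) - Γ x' + f` of `N` atoms, its linearization
`F ≈ -A x`, and an orthogonal splitting `x = Φ q + Ψ ξ` with `m` coarse-grained variables `q`. -/
structure LangevinModel (N m : ℕ) where
  /-- the force (`F = -∇V` for a `C¹` potential `V`) -/
  F : (Fin (3 * N) → ℝ) → (Fin (3 * N) → ℝ)
  /-- the linearized force constant matrix -/
  A : Matrix (Fin (3 * N)) (Fin (3 * N)) ℝ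
  /-- the damping matrix -/
  Γ : Matrix (Fin (3 * N)) (Fin (3 * N)) ℝ
  /-- basis of the coarse-grained subspace -/
  Φ : Matrix (Fin (3 * N)) (Fin m) ℝ
  /-- basis of its orthogonal complement -/
  Ψ : Matrix (Fin (3 * N)) (Fin (3 * N - m)) ℝ
  continuous_F : Continuous F
  posDef_A : A.PosDef
  posSemidef_Γ : Γ.PosSemidef
  orth_Φ : Φᵀ * Φ = 1
  orth_Ψ : Ψᵀ * Ψ = 1
  orth_ΦΨ : Φᵀ * Ψ = 0

namespace LangevinModel

variable {N m : ℕ} (M : LangevinModel N m)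

/-- `A₁₂ = Φᵀ A Ψ` -/
def A12 : Matrix (Fin m) (Fin (3 * N - m)) ℝ := M.Φᵀ * M.A * M.Ψ
/-- `A₂₁ = Ψᵀ A Φ` -/
def A21 : Matrix (Fin (3 * N - m)) (Fin m) ℝ := M.Ψᵀ * M.A * M.Φ
/-- `A₂₂ = Ψᵀ A Ψ` -/
def A22 : Matrix (Fin (3 * N - m)) (Fin (3 * N - m)) ℝ := M.Ψᵀ * M.A * M.Ψ
/-- `Γ₁₁ = Φᵀ Γ Φ` -/
def Γ11 : Matrix (Fin m) (Fin m) ℝ := M.Φᵀ * M.Γ * M.Φ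
/-- `Γ₁₂ = Φᵀ Γ Ψ` -/
def Γ12 : Matrix (Fin m) (Fin (3 * N - m)) ℝ := M.Φᵀ * M.Γ * M.Ψ
/-- `Γ₂₁ = Ψᵀ Γ Φ` -/
def Γ21 : Matrix (Fin (3 * N - m)) (Fin m) ℝ := M.Ψᵀ * M.Γ * M.Φ
/-- `Γ₂₂ = Ψᵀ Γ Ψ` -/
def Γ22 : Matrix (Fin (3 * N - m)) (Fin (3 * N - m)) ℝ := M.Ψᵀ * M.Γ * M.Ψ

/-- The effective force `F_eff(q) = Φᵀ F(Φ q) - A₁₂ A₂₂⁻¹ A₂₁ q`. -/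
noncomputable def Feff (q : Fin m → ℝ) : Fin m → ℝ :=
  M.Φᵀ *ᵥ M.F (M.Φ *ᵥ q) - (M.A12 * M.A22⁻¹ * M.A21) *ᵥ q

/-- The matrix `G = [[0, -I], [A₂₂, Γ₂₂]]`. -/
def G : Matrix (Fin (3 * N - m) ⊕ Fin (3 * N - m)) (Fin (3 * N - m) ⊕ Fin (3 * N - m)) ℝ :=
  Matrix.fromBlocks 0 (-1) M.A22 M.Γ22

/-- The exact memory kernel
`θ(t) = [A₁₂, Γ₁₂] e^{-Gt} [[A₂₂⁻¹, 0], [0, -I]] [A₂₁; Γ₂₁]`. -/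
noncomputable def kernel (t : ℝ) : Matrix (Fin m) (Fin m) ℝ :=
  Matrix.fromCols M.A12 M.Γ12 *
    (NormedSpace.exp (t • (-M.G)) :
      Matrix (Fin (3 * N - m) ⊕ Fin (3 * N - m)) (Fin (3 * N - m) ⊕ Fin (3 * N - m)) ℝ) *
    (Matrix.fromBlocks M.A22⁻¹ 0 0 (-1) :
      Matrix (Fin (3 * N - m) ⊕ Fin (3 * N - m)) (Fin (3 * N - m) ⊕ Fin (3 * N - m)) ℝ) *
    Matrix.fromRows M.A21 M.Γ21

/-- The derivative `θ^{(ℓ)}(0)` of the exact memory kernel at time `0`. -/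
noncomputable def kernelDeriv (l : ℕ) : Matrix (Fin m) (Fin m) ℝ :=
  Matrix.of fun i j => iteratedDeriv l (fun t => M.kernel t i j) 0

/-- `M_∞ = ∫₀^∞ θ(t) dt`. -/
noncomputable def kernelIntegral : Matrix (Fin m) (Fin m) ℝ :=
  Matrix.of fun i j => ∫ t in Ioi (0 : ℝ), M.kernel t i j

end LangevinModel

/-- The Laplace transform `∫₀^∞ K(t) e^{-t/lam} dt` of a matrix kernel, in the variable
`lam = 1 / s`. -/
noncomputable def laplace {m : ℕ} (K : ℝ → Matrix (Fin m) (Fin m) ℝ) (lam : ℝ) :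
    Matrix (Fin m) (Fin m) ℝ :=
  Matrix.of fun i j => ∫ t in Ioi (0 : ℝ), K t i j * Real.exp (-t / lam)

/-- The coefficients of the second-order rational approximation. -/
structure Coeffs (m : ℕ) where
  /-- denominator, first order -/
  B0 : Matrix (Fin m) (Fin m) ℝ
  /-- denominator, second order -/
  B1 : Matrix (Fin m) (Fin m) ℝ
  /-- numerator, first order -/
  C0 : Matrix (Fin m) (Fin m) ℝ
  /-- numerator, second order -/
  C1 : Matrix (Fin m) (Fin m) ℝ

namespace Coeffs

variable {m : ℕ} (c : Coeffs m)

/-- `R₂₂(lam) = [I - lam B₀ - lam² B₁]⁻¹ [lam C₀ + lam² C₁]`. -/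
noncomputable def R22 (lam : ℝ) : Matrix (Fin m) (Fin m) ℝ :=
  (1 - lam • c.B0 - lam ^ 2 • c.B1)⁻¹ * (lam • c.C0 + lam ^ 2 • c.C1)

/-- Moment matching: the expansions of `Θ` (the Laplace transform of `K`) and of `R₂₂` at
`lam = 0⁺` agree up to and including the third order (both vanish at `0`), and
`Θ(+∞) = R₂₂(+∞)`. -/
structure MomentMatching (K : ℝ → Matrix (Fin m) (Fin m) ℝ) : Prop where
  at_zero : ∀ i j, (fun lam : ℝ => laplace K lam i j - c.R22 lam i j)
    =o[𝓝[>] (0 : ℝ)] fun lam : ℝ => lam ^ 3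
  at_infty : Tendsto (fun lam : ℝ => laplace K lam - c.R22 lam) atTop (𝓝 0)

/-- `B̂ = [[0, B₁], [I, B₀]]`, the drift matrix of `(z₁, z)`. -/
def Bhat : Matrix (Fin m ⊕ Fin m) (Fin m ⊕ Fin m) ℝ :=
  Matrix.fromBlocks 0 c.B1 1 c.B0

/-- The approximate memory kernel `[0, I] e^{t B̂} [C₁; C₀]`. -/
noncomputable def kernel (t : ℝ) : Matrix (Fin m) (Fin m) ℝ :=
  Matrix.fromCols (0 : Matrix (Fin m) (Fin m) ℝ) (1 : Matrix (Fin m) (Fin m) ℝ) *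
    (NormedSpace.exp (t • c.Bhat) : Matrix (Fin m ⊕ Fin m) (Fin m ⊕ Fin m) ℝ) *
    Matrix.fromRows c.C1 c.C0

/-- `Q = [[Q₁, Q₁₂], [Q₁₂ᵀ, Q₂]]` with `Q₁ = -C₀ᵀ B₁ᵀ - B₀ C₁ᵀ`, `Q₁₂ = C₁`, `Q₂ = C₀`. -/
def Q : Matrix (Fin m ⊕ Fin m) (Fin m ⊕ Fin m) ℝ :=
  Matrix.fromBlocks (-(c.C0ᵀ * c.B1ᵀ) - c.B0 * c.C1ᵀ) c.C1 c.C1ᵀ c.C0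

/-- The solution `S` of the Lyapunov equation `B̂ Q + Q B̂ᵀ = -S`. -/
def noiseCov : Matrix (Fin m ⊕ Fin m) (Fin m ⊕ Fin m) ℝ :=
  -(c.Bhat * c.Q + c.Q * c.Bhatᵀ)

end Coeffs

/-- `W` is the time integral of a Gaussian white noise `ζ` with
`⟨ζ(t) ζ(t')ᵀ⟩ = S δ(t - t')`, i.e. a Wiener process with covariance matrix `S`.
Processes are indexed by `ℝ` for convenience; only times `t ≥ 0` matter. -/
structure IsWiener {Ω ι : Type*} [Fintype ι] [MeasurableSpace Ω] (P : Measure Ω)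
    (S : Matrix ι ι ℝ) (W : ℝ → Ω → (ι → ℝ)) : Prop where
  gaussian : IsGaussianProcess (fun t : ℝ≥0 => W t) P
  mean : ∀ t, 0 ≤ t → ∀ i, ∫ ω, W t ω i ∂P = 0
  cov : ∀ s t, 0 ≤ s → 0 ≤ t → ∀ i j, ∫ ω, W s ω i * W t ω j ∂P = min s t * S i j
  zero : ∀ᵐ ω ∂P, W 0 ω = 0
  cont : ∀ᵐ ω ∂P, ContinuousOn (fun t => W t ω) (Ici 0)

/-- `X` is a centered Gaussian random vector with covariance matrix `S`. -/
structure IsCenteredGaussian {Ω ι : Type*} [Fintype ι] [MeasurableSpace Ω] (P : Measure Ω)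
    (S : Matrix ι ι ℝ) (X : Ω → (ι → ℝ)) : Prop where
  gaussian : HasGaussianLaw X P
  mean : ∀ i, ∫ ω, X ω i ∂P = 0
  cov : ∀ i j, ∫ ω, X ω i * X ω j ∂P = S i j

/-- Paths `(q, p, z₁, z)` solving the second-order model
`q' = p`, `p' = F_eff(q) - Γ₁₁ p - z + f₁`, `z₁' = B₁ z + C₁ p + ζ₁`, `z' = z₁ + B₀ z + C₀ p + ζ`,
in integrated form; `w₁` is the integral of `f₁` and `w` is the integral of `(ζ₁, ζ)`. -/
structure SolvesSecondOrder {N m : ℕ} (M : LangevinModel N m) (c : Coeffs m)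
    (w₁ : ℝ → Fin m → ℝ) (w : ℝ → Fin m ⊕ Fin m → ℝ) (q p z₁ z : ℝ → Fin m → ℝ) : Prop where
  cont_q : ContinuousOn q (Ici 0)
  cont_p : ContinuousOn p (Ici 0)
  cont_z₁ : ContinuousOn z₁ (Ici 0)
  cont_z : ContinuousOn z (Ici 0)
  eq_q : ∀ t, 0 ≤ t → q t = q 0 + ∫ s in (0 : ℝ)..t, p s
  eq_p : ∀ t, 0 ≤ t →
    p t = p 0 + (∫ s in (0 : ℝ)..t, (M.Feff (q s) - M.Γ11 *ᵥ p s - z s)) + w₁ t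
  eq_z₁ : ∀ t, 0 ≤ t →
    z₁ t = z₁ 0 + (∫ s in (0 : ℝ)..t, (c.B1 *ᵥ z s + c.C1 *ᵥ p s)) + fun i => w t (Sum.inl i)
  eq_z : ∀ t, 0 ≤ t →
    z t = z 0 + (∫ s in (0 : ℝ)..t, (z₁ s + c.B0 *ᵥ z s + c.C0 *ᵥ p s))
      + fun i => w t (Sum.inr i)

/-- The memory term `∫₀ᵗ K(t - τ) p(τ) dτ`. -/
noncomputable def memory {m : ℕ} (K : ℝ → Matrix (Fin m) (Fin m) ℝ) (p : ℝ → Fin m → ℝ)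
    (t : ℝ) : Fin m → ℝ :=
  ∫ τ in (0 : ℝ)..t, K (t - τ) *ᵥ p τ

/-- Paths `(q, p)` solving the generalized Langevin equation
`q' = p`, `p' = F_eff(q) - Γ₁₁ p - ∫₀ᵗ K(t - τ) p(τ) dτ + f`,
in integrated form; `n` is the integral of the noise `f`. -/
structure SolvesGLE {N m : ℕ} (M : LangevinModel N m) (K : ℝ → Matrix (Fin m) (Fin m) ℝ)
    (n : ℝ → Fin m → ℝ) (q p : ℝ → Fin m → ℝ) : Prop where
  cont_q : ContinuousOn q (Ici 0)
  cont_p : ContinuousOn p (Ici 0)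
  eq_q : ∀ t, 0 ≤ t → q t = q 0 + ∫ s in (0 : ℝ)..t, p s
  eq_p : ∀ t, 0 ≤ t →
    p t = p 0 + (∫ s in (0 : ℝ)..t, (M.Feff (q s) - M.Γ11 *ᵥ p s - memory K p s)) + n t

/-- The path `e^{tB} x₀ + ∫₀ᵗ e^{(t-s)B} dw(s)`; the Wiener integral of the smooth deterministic
integrand is written by integration by parts (`w` is continuous with `w 0 = 0`). -/
noncomputable def ouPath {ι : Type*} [Fintype ι] [DecidableEq ι] (B : Matrix ι ι ℝ)
    (x₀ : ι → ℝ) (w : ℝ → ι → ℝ) (t : ℝ) : ι → ℝ :=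
  NormedSpace.exp (t • B) *ᵥ x₀ +
    (w t + ∫ s in (0 : ℝ)..t, (B * NormedSpace.exp ((t - s) • B)) *ᵥ w s)

/-- The generated colored noise
`g(t) = [0, I] (e^{tB̂} (z₁(0), z(0)) + ∫₀ᵗ e^{(t-s)B̂} (ζ₁(s), ζ(s)) ds)`. -/
noncomputable def coloredNoise {Ω : Type*} {m : ℕ} (c : Coeffs m)
    (Z₀ : Ω → Fin m ⊕ Fin m → ℝ) (W : ℝ → Ω → (Fin m ⊕ Fin m → ℝ)) (t : ℝ) (ω : Ω) :
    Fin m → ℝ :=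
  fun i => ouPath c.Bhat (Z₀ ω) (fun s => W s ω) t (Sum.inr i)

/-- The time integral of the total noise `f₁ - g` that acts on `p` (the memory variable enters
the momentum equation with a minus sign). -/
noncomputable def totalNoise {Ω : Type*} {m : ℕ} (c : Coeffs m)
    (Z₀ : Ω → Fin m ⊕ Fin m → ℝ) (W : ℝ → Ω → (Fin m ⊕ Fin m → ℝ)) (W₁ : ℝ → Ω → (Fin m → ℝ))
    (t : ℝ) (ω : Ω) : Fin m → ℝ :=
  W₁ t ω - ∫ s in (0 : ℝ)..t, coloredNoise c Z₀ W s ω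

/-- The kernel extended to negative times by `K(-t) = K(t)ᵀ`, as a correlation function is. -/
noncomputable def extend {m : ℕ} (K : ℝ → Matrix (Fin m) (Fin m) ℝ) (t : ℝ) :
    Matrix (Fin m) (Fin m) ℝ :=
  if 0 ≤ t then K t else (K (-t))ᵀ

/-- The second fluctuation-dissipation theorem
`⟨f(t) f(t')ᵀ⟩ = 2 kT Γ₁₁ δ(t - t') + kT K(t - t')` for the noise `f` whose time integral is the
centered process `n`. Since `f` contains a white noise, the identity of distributions is stated
after integrating over `[0, s] × [0, t]`. -/
def SecondFDT {Ω : Type*} [MeasurableSpace Ω] {m : ℕ} (P : Measure Ω) (kT : ℝ)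
    (Γ₁₁ : Matrix (Fin m) (Fin m) ℝ) (K : ℝ → Matrix (Fin m) (Fin m) ℝ)
    (n : ℝ → Ω → (Fin m → ℝ)) : Prop :=
  ∀ s t, 0 ≤ s → 0 ≤ t → ∀ i j,
    Integrable (fun ω => n s ω i * n t ω j) P ∧
    ∫ ω, n s ω i * n t ω j ∂P =
      2 * kT * Γ₁₁ i j * min s t
        + kT * ∫ u in (0 : ℝ)..s, ∫ v in (0 : ℝ)..t, extend K (u - v) i j

end CoarseGrain

-- The pair `y = (z₁, z)` solves a linear equation `y' = B̂ y + [C₁; C₀] p + (ζ₁, ζ)`. Variation of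
-- constants splits `y` into the response to `p` starting from rest, whose lower half is the memory
-- integral with kernel `θ₂`, and an Ornstein-Uhlenbeck process, whose lower half is `g`.
-- Substituting `z = memory + g` in the momentum equation gives the generalized Langevin equation.
-- Conversely, the same formula constructs `(z₁, z)` from `p`. The noise is additive, so this holds
-- path by path for continuous `w` (`exists_solvesSecondOrder_iff`); uniqueness is Gronwall's
-- inequality (`volterra_unique`).
--
-- The Lyapunov equation makes the Ornstein-Uhlenbeck process stationary, with correlation
-- `e^{(t-s)B̂} kT Q` (`ouPath_covariance`). The right block column of `Q` is `[C₁; C₀]`, the very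
-- matrix through which `p` enters. So the lower right block of the correlation is `kT θ₂`
-- (`Coeffs.exp_mul_Q`), which is the fluctuation-dissipation relation; the independent white noise
-- `f₁` adds its own covariance.
--
-- No stochastic integration is used. The correlation of the process with a fixed Gaussian variable
-- solves a deterministic linear Volterra equation (`ouPath_moment_eq`), solved in turn against the
-- initial value, the past noise and the process itself. This requires exchanging expectations and
-- time integrals. All variables lie in a linear space of centered Gaussians closed under almost
-- sure limits; there almost sure convergence forces convergence of second moments
-- (`gaussian_of_tendsto_ae`), so Riemann sums suffice (`IsGaussianSpace.integral_mem`). Joint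
-- Gaussianity is then automatic, and stationarity reduces to covariances
-- (`IsGaussianSpace.map_eq_map`).
--
-- For the moments, the Laplace transform of `L e^{tX} R` at `1/lam` is `lam L (1 - lam X)⁻¹ R`
-- (`laplace_of_exp`). With `X = B̂` it equals `R₂₂`. With `X = -G` the resolvent is expanded,
-- multiplied by the denominator of `R₂₂`, and coefficients up to `lam³` are compared. At infinity
-- `Θ` tends to `M_∞`, and the leading terms of denominator and numerator give the last equation.

namespace CoarseGrain

-- Gaussian spaces closed under almost sure limits.

section GaussianSpace

variable {Ω : Type*} [MeasurableSpace Ω] {P : Measure Ω}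

/-- A centered Gaussian random variable with second moment `v`. -/
theorem map_eq_gaussianReal_of_mean_zero {f : Ω → ℝ} (hf : HasGaussianLaw f P)
    (h0 : ∫ ω, f ω ∂P = 0) :
    P.map f = gaussianReal 0 (∫ ω, f ω ^ 2 ∂P).toNNReal := by
  rw [hf.map_eq_gaussianReal, h0]
  congr 2
  rw [variance_of_integral_eq_zero hf.aemeasurable h0]

/-- An almost sure limit of centered Gaussian random variables is a centered Gaussian random
variable, and the second moments converge. -/
theorem gaussian_of_tendsto_ae {u : ℕ → Ω → ℝ} {f : Ω → ℝ}
    (hu : ∀ n, HasGaussianLaw (u n) P) (hu0 : ∀ n, ∫ ω, u n ω ∂P = 0)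
    (hf : ∀ᵐ ω ∂P, Tendsto (fun n => u n ω) atTop (𝓝 (f ω))) :
    HasGaussianLaw f P ∧ ∫ ω, f ω ∂P = 0 ∧
      Tendsto (fun n => ∫ ω, u n ω ^ 2 ∂P) atTop (𝓝 (∫ ω, f ω ^ 2 ∂P)) := by
  have hP : IsProbabilityMeasure P := (hu 0).isProbabilityMeasure
  have hfm : AEMeasurable f P := aemeasurable_of_tendsto_metrizable_ae' (fun n => (hu n).aemeasurable) hf
  have hPf : IsProbabilityMeasure (P.map f) := P.isProbabilityMeasure_map hfm
  set v : ℕ → ℝ := fun n => ∫ ω, u n ω ^ 2 ∂P with hv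
  have hv0 : ∀ n, 0 ≤ v n := fun n => integral_nonneg fun ω => sq_nonneg _
  have hchar : ∀ n t, charFun (P.map (u n)) t = ((Real.exp (-(v n * t ^ 2 / 2)) : ℝ) : ℂ) := by
    intro n t
    rw [map_eq_gaussianReal_of_mean_zero (hu n) (hu0 n), charFun_gaussianReal,
      Real.coe_toNNReal _ (hv0 n)]
    push_cast
    congr 1
    simp [hv]
  have hmap : ∀ (g : Ω → ℝ), AEMeasurable g P → ∀ t,
      charFun (P.map g) t = ∫ ω, Complex.exp (t * g ω * Complex.I) ∂P := by
    intro g hg t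
    rw [charFun_apply_real, integral_map hg (by fun_prop)]
  have hlim : ∀ t, Tendsto (fun n => charFun (P.map (u n)) t) atTop (𝓝 (charFun (P.map f) t)) := by
    intro t
    rw [hmap f hfm]
    simp_rw [fun n => hmap (u n) (hu n).aemeasurable t]
    refine tendsto_integral_of_dominated_convergence (fun _ => 1) ?_ (integrable_const _) ?_ ?_
    · intro n
      have := (hu n).aemeasurable
      exact (by fun_prop : AEMeasurable (fun ω => Complex.exp (t * u n ω * Complex.I)) P).aestronglyMeasurable
    · intro n
      refine ae_of_all _ fun ω => ?_
      rw [← Complex.ofReal_mul, Complex.norm_exp_ofReal_mul_I]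
    · filter_upwards [hf] with ω hω
      have hc : Continuous fun x : ℝ => Complex.exp (t * x * Complex.I) := by fun_prop
      exact (hc.tendsto _).comp hω
  have hre : ∀ t, Tendsto (fun n => Real.exp (-(v n * t ^ 2 / 2))) atTop
      (𝓝 (charFun (P.map f) t).re) := by
    intro t
    have := (Complex.continuous_re.tendsto _).comp (hlim t)
    refine this.congr fun n => ?_
    simp only [Function.comp, hchar, Complex.ofReal_re]
  -- The values `exp (-(v n * t ^ 2 / 2))` determine the limit of `v n` only if their own limit is
  -- nonzero. The limiting characteristic function is continuous and equals 1 at 0, so some `t₀ > 0`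
  -- qualifies, and `v n` is recovered by a logarithm.
  obtain ⟨t₀, ht₀, hpos⟩ : ∃ t₀ : ℝ, 0 < t₀ ∧ 0 < (charFun (P.map f) t₀).re := by
    have hc : Continuous fun t => (charFun (P.map f) t).re :=
      Complex.continuous_re.comp continuous_charFun
    have h1 : 0 < (charFun (P.map f) 0).re := by simp
    have h2 : ∀ᶠ t in 𝓝[>] (0 : ℝ), 0 < (charFun (P.map f) t).re :=
      nhdsWithin_le_nhds ((hc.tendsto 0).eventually (lt_mem_nhds h1))
    obtain ⟨t, h3, h4⟩ := (h2.and self_mem_nhdsWithin).exists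
    exact ⟨t, h4, h3⟩
  set w : ℝ := -2 / t₀ ^ 2 * Real.log (charFun (P.map f) t₀).re with hw
  have hvw : Tendsto v atTop (𝓝 w) := by
    have h1 := ((Real.continuousAt_log hpos.ne').tendsto.comp (hre t₀)).const_mul (-2 / t₀ ^ 2)
    refine h1.congr fun n => ?_
    simp only [Function.comp, Real.log_exp]
    field_simp
  have hw0 : 0 ≤ w := ge_of_tendsto' hvw hv0
  have hlaw : P.map f = gaussianReal 0 w.toNNReal := by
    refine Measure.ext_of_charFun ?_
    ext t
    rw [charFun_gaussianReal, Real.coe_toNNReal _ hw0]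
    refine tendsto_nhds_unique (hlim t) ?_
    simp_rw [hchar]
    have hc : Continuous fun x : ℝ => ((Real.exp (-(x * t ^ 2 / 2)) : ℝ) : ℂ) := by fun_prop
    convert (hc.tendsto w).comp hvw using 2
    push_cast
    congr 1
    simp
  have hG : HasGaussianLaw f P := ⟨by rw [hlaw]; infer_instance⟩
  have h0 : ∫ ω, f ω ∂P = 0 := by
    have := integral_map (f := fun x : ℝ => x) hfm (by fun_prop)
    rw [← this, hlaw, integral_id_gaussianReal]
  refine ⟨hG, h0, ?_⟩
  have h2 : ∫ ω, f ω ^ 2 ∂P = w := by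
    rw [← variance_of_integral_eq_zero hfm h0]
    have := variance_map (μ := P) (X := fun x : ℝ => x) (Y := f) (by fun_prop) hfm
    rw [show f = (fun x : ℝ => x) ∘ f from rfl, ← this, hlaw, variance_fun_id_gaussianReal,
      Real.coe_toNNReal _ hw0]
  rw [h2]
  exact hvw

/-- A linear space of centered Gaussian random variables that is closed under almost sure limits
of sequences. -/
structure IsGaussianSpace (P : Measure Ω) (H : Submodule ℝ (Ω → ℝ)) : Prop where
  gaussian : ∀ f ∈ H, HasGaussianLaw f P
  mean : ∀ f ∈ H, ∫ ω, f ω ∂P = 0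
  closed : ∀ (u : ℕ → Ω → ℝ) (f : Ω → ℝ), (∀ n, u n ∈ H) →
    (∀ᵐ ω ∂P, Tendsto (fun n => u n ω) atTop (𝓝 (f ω))) → f ∈ H

/-- Every linear space of centered Gaussian random variables is contained in a closed one. -/
theorem exists_isGaussianSpace (H₀ : Submodule ℝ (Ω → ℝ))
    (h₀ : ∀ f ∈ H₀, HasGaussianLaw f P ∧ ∫ ω, f ω ∂P = 0) :
    ∃ H, H₀ ≤ H ∧ IsGaussianSpace P H := by
  -- A maximal space of centered Gaussians is closed: if `u n → f` almost surely, each `h + a • f`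
  -- is the limit of `h + a • u n`, hence centered Gaussian, so adjoining `f` cannot enlarge the
  -- space.
  obtain ⟨H, hH, hmax⟩ := zorn_le_nonempty₀
    {H : Submodule ℝ (Ω → ℝ) | ∀ f ∈ H, HasGaussianLaw f P ∧ ∫ ω, f ω ∂P = 0} (by
      intro c hc hchain y hy
      refine ⟨sSup c, ?_, fun z hz => le_sSup hz⟩
      intro f hf
      obtain ⟨z, hz, hfz⟩ := (Submodule.mem_sSup_of_directed ⟨y, hy⟩ hchain.directedOn).1 hf
      exact hc hz f hfz) H₀ h₀
  refine ⟨H, hH, fun f hf => (hmax.prop f hf).1, fun f hf => (hmax.prop f hf).2, ?_⟩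
  intro u f hu hf
  have hsup : ∀ g ∈ H ⊔ Submodule.span ℝ {f}, HasGaussianLaw g P ∧ ∫ ω, g ω ∂P = 0 := by
    intro g hg
    obtain ⟨h, hh, k, hk, rfl⟩ := Submodule.mem_sup.1 hg
    obtain ⟨a, rfl⟩ := Submodule.mem_span_singleton.1 hk
    have hmem : ∀ n, h + a • u n ∈ H := fun n => H.add_mem hh (H.smul_mem a (hu n))
    have := gaussian_of_tendsto_ae (u := fun n => h + a • u n) (f := h + a • f)
      (fun n => (hmax.prop _ (hmem n)).1) (fun n => (hmax.prop _ (hmem n)).2) (by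
        filter_upwards [hf] with ω hω
        simpa using (hω.const_mul a).const_add (h ω))
    exact ⟨this.1, this.2.1⟩
  exact hmax.le_of_ge hsup le_sup_left (Submodule.mem_sup_right (Submodule.mem_span_singleton_self f))

namespace IsGaussianSpace

variable {H : Submodule ℝ (Ω → ℝ)} (hH : IsGaussianSpace P H)
include hH

theorem congr_ae {f g : Ω → ℝ} (hf : f ∈ H) (hfg : f =ᵐ[P] g) : g ∈ H := by
  refine hH.closed (fun _ => f) g (fun _ => hf) ?_
  filter_upwards [hfg] with ω hω
  rw [hω]
  exact tendsto_const_nhds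

theorem memLp_two {f : Ω → ℝ} (hf : f ∈ H) : MemLp f 2 P := (hH.gaussian f hf).memLp_two

theorem integrable_mul {f g : Ω → ℝ} (hf : f ∈ H) (hg : g ∈ H) :
    Integrable (fun ω => f ω * g ω) P :=
  (hH.memLp_two hf).integrable_mul (hH.memLp_two hg)

theorem integrable_sq {f : Ω → ℝ} (hf : f ∈ H) : Integrable (fun ω => f ω ^ 2) P :=
  (hH.memLp_two hf).integrable_sq

/-- Second moments in a Gaussian space are continuous along almost surely convergent sequences. -/
theorem tendsto_integral_mul {u : ℕ → Ω → ℝ} {f g : Ω → ℝ} (hu : ∀ n, u n ∈ H)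
    (hf : ∀ᵐ ω ∂P, Tendsto (fun n => u n ω) atTop (𝓝 (f ω))) (hg : g ∈ H) :
    Tendsto (fun n => ∫ ω, u n ω * g ω ∂P) atTop (𝓝 (∫ ω, f ω * g ω ∂P)) := by
  have hfH := hH.closed u f hu hf
  -- Polarization, since the limit theorem controls squares only.
  have key : ∀ h ∈ H, ∫ ω, h ω * g ω ∂P
      = (∫ ω, (h + g) ω ^ 2 ∂P - ∫ ω, (h - g) ω ^ 2 ∂P) / 4 := by
    intro h hh
    rw [← integral_sub (hH.integrable_sq (H.add_mem hh hg)) (hH.integrable_sq (H.sub_mem hh hg)),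
      ← integral_div]
    congr 1
    ext ω
    simp only [Pi.add_apply, Pi.sub_apply]
    ring
  simp_rw [fun n => key (u n) (hu n)]
  rw [key f hfH]
  refine Tendsto.div_const (Tendsto.sub ?_ ?_) 4
  · refine (gaussian_of_tendsto_ae (u := fun n => u n + g) (f := f + g)
      (fun n => hH.gaussian _ (H.add_mem (hu n) hg)) (fun n => hH.mean _ (H.add_mem (hu n) hg))
      ?_).2.2
    filter_upwards [hf] with ω hω
    simpa using hω.add_const (g ω)
  · refine (gaussian_of_tendsto_ae (u := fun n => u n - g) (f := f - g)
      (fun n => hH.gaussian _ (H.sub_mem (hu n) hg)) (fun n => hH.mean _ (H.sub_mem (hu n) hg))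
      ?_).2.2
    filter_upwards [hf] with ω hω
    simpa using hω.sub_const (g ω)

end IsGaussianSpace

/-- Convergence of the left Riemann sums of a continuous function. -/
theorem tendsto_riemannSum {f : ℝ → ℝ} {T : ℝ} (hT : 0 ≤ T) (hf : ContinuousOn f (Icc 0 T)) :
    Tendsto (fun n : ℕ => ∑ k ∈ Finset.range n, T / n * f (k * (T / n))) atTop
      (𝓝 (∫ t in (0 : ℝ)..T, f t)) := by
  rw [Metric.tendsto_atTop]
  intro ε hε
  have huc := isCompact_Icc.uniformContinuousOn_of_continuous hf
  rw [Metric.uniformContinuousOn_iff] at huc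
  -- The denominator `T + 1` stays positive for `T = 0` and makes the final bound `ε * (T / (T +
  -- 1))` strictly smaller than `ε`.
  obtain ⟨δ, hδ, huc⟩ := huc (ε / (T + 1)) (by positivity)
  obtain ⟨M, hM⟩ := exists_nat_gt (T / δ)
  refine ⟨M + 1, fun n hn => ?_⟩
  have hn0 : (0 : ℝ) < n := by exact_mod_cast (by omega : 0 < n)
  have hstep : T / n < δ := by
    rw [div_lt_iff₀ hn0]
    rw [div_lt_iff₀ hδ] at hM
    have : (M : ℝ) ≤ n := by exact_mod_cast (by omega : M ≤ n)
    nlinarith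
  have hs0 : 0 ≤ T / n := by positivity
  have hle : ∀ k ≤ n, (k : ℝ) * (T / n) ≤ T := by
    intro k hk
    have hk' : (k : ℝ) ≤ n := by exact_mod_cast hk
    calc (k : ℝ) * (T / n) ≤ n * (T / n) := by gcongr
      _ = T := by field_simp
  have hsub : ∀ k < n, Icc ((k : ℝ) * (T / n)) ((k + 1 : ℕ) * (T / n)) ⊆ Icc 0 T := fun k hk =>
    Icc_subset_Icc (by positivity) (hle _ hk)
  have hmono : ∀ k : ℕ, (k : ℝ) * (T / n) ≤ (k + 1 : ℕ) * (T / n) := fun k => by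
    push_cast; nlinarith
  have hint : ∀ k < n, IntervalIntegrable f volume ((k : ℝ) * (T / n)) ((k + 1 : ℕ) * (T / n)) :=
    fun k hk => ContinuousOn.intervalIntegrable_of_Icc (hmono k) (hf.mono (hsub k hk))
  have hsum := intervalIntegral.sum_integral_adjacent_intervals
    (a := fun k : ℕ => (k : ℝ) * (T / n)) (n := n) hint
  have hend : (n : ℝ) * (T / n) = T := by field_simp
  simp only [Nat.cast_zero, zero_mul, hend] at hsum
  rw [← hsum, dist_eq_norm, ← Finset.sum_sub_distrib]
  calc _ ≤ ∑ k ∈ Finset.range n, ε / (T + 1) * (T / n) := by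
        refine norm_sum_le_of_le _ fun k hk => ?_
        have hk := Finset.mem_range.1 hk
        have h1 : T / n * f (k * (T / n)) =
            ∫ t in ((k : ℝ) * (T / n))..((k + 1 : ℕ) * (T / n)), f (k * (T / n)) := by
          rw [intervalIntegral.integral_const, smul_eq_mul]
          push_cast
          ring
        rw [h1, ← intervalIntegral.integral_sub (by simp) (hint k hk)]
        have h2 := intervalIntegral.norm_integral_le_of_norm_le_const
          (f := fun t => f (k * (T / n)) - f t) (C := ε / (T + 1))
          (a := (k : ℝ) * (T / n)) (b := (k + 1 : ℕ) * (T / n)) (by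
            intro t ht
            rw [uIoc_of_le (hmono k)] at ht
            rw [← dist_eq_norm]
            refine (huc _ (hsub k hk ⟨le_rfl, hmono k⟩) _ (hsub k hk ⟨ht.1.le, ht.2⟩) ?_).le
            have := ht.2
            push_cast at this
            rw [dist_comm, Real.dist_eq, abs_of_pos (by linarith [ht.1])]
            linarith)
        refine h2.trans_eq ?_
        rw [abs_of_nonneg (by linarith [hmono k])]
        push_cast
        ring
    _ = ε * (T / (T + 1)) := by
        rw [Finset.sum_const, Finset.card_range, nsmul_eq_mul]
        field_simp
    _ < ε * 1 := by
        gcongr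
        rw [div_lt_one (by positivity)]
        linarith
    _ = ε := mul_one _

namespace IsGaussianSpace

variable {H : Submodule ℝ (Ω → ℝ)} (hH : IsGaussianSpace P H)
include hH

/-- No dominating function is needed: along sequences, pathwise continuity already gives convergence
of second moments. -/
theorem continuousOn_integral_mul {X : ℝ → Ω → ℝ} {s : Set ℝ} (hX : ∀ t ∈ s, X t ∈ H)
    (hc : ∀ᵐ ω ∂P, ContinuousOn (fun t => X t ω) s) {g : Ω → ℝ} (hg : g ∈ H) :
    ContinuousOn (fun t => ∫ ω, X t ω * g ω ∂P) s := by
  rw [continuousOn_iff_continuous_domRestrict, continuous_iff_seqContinuous]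
  intro x a hx
  refine hH.tendsto_integral_mul (u := fun n => X (x n)) (f := X a) (fun n => hX _ (x n).2) ?_ hg
  filter_upwards [hc] with ω hω
  exact ((continuousOn_iff_continuous_domRestrict.1 hω).tendsto a).comp hx

/-- The time integral of a process with continuous paths in a Gaussian space belongs to the space,
and its second moments are the integrated second moments. -/
theorem integral_mem {X : ℝ → Ω → ℝ} {T : ℝ} (hT : 0 ≤ T) (hX : ∀ t ∈ Icc 0 T, X t ∈ H)
    (hc : ∀ᵐ ω ∂P, ContinuousOn (fun t => X t ω) (Icc 0 T)) :
    (fun ω => ∫ t in (0 : ℝ)..T, X t ω) ∈ H ∧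
    ∀ g ∈ H, ∫ ω, (∫ t in (0 : ℝ)..T, X t ω) * g ω ∂P =
      ∫ t in (0 : ℝ)..T, ∫ ω, X t ω * g ω ∂P := by
  -- The Riemann sums converge pathwise to the time integral, while their second moments are Riemann
  -- sums of the second moments. Uniqueness of limits replaces Fubini, so joint measurability of `X`
  -- plays no role.
  set S : ℕ → Ω → ℝ := fun n => ∑ k ∈ Finset.range n, (T / n) • X (k * (T / n)) with hS
  have hmem : ∀ n : ℕ, ∀ k ∈ Finset.range n, X (k * (T / n)) ∈ H := by
    intro n k hk
    have hk := Finset.mem_range.1 hk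
    have hn0 : (0 : ℝ) < n := by exact_mod_cast (by omega : 0 < n)
    have hk' : (k : ℝ) ≤ n := by exact_mod_cast hk.le
    refine hX _ ⟨by positivity, ?_⟩
    calc (k : ℝ) * (T / n) ≤ n * (T / n) := by gcongr
      _ = T := by field_simp
  have hSH : ∀ n, S n ∈ H := fun n =>
    H.sum_mem fun k hk => H.smul_mem _ (hmem n k hk)
  have hlim : ∀ᵐ ω ∂P, Tendsto (fun n => S n ω) atTop (𝓝 (∫ t in (0 : ℝ)..T, X t ω)) := by
    filter_upwards [hc] with ω hω
    simpa [hS] using tendsto_riemannSum hT hω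
  refine ⟨hH.closed S _ hSH hlim, fun g hg => ?_⟩
  refine tendsto_nhds_unique (hH.tendsto_integral_mul hSH hlim hg) ?_
  refine (tendsto_riemannSum hT (hH.continuousOn_integral_mul hX hc hg)).congr fun n => ?_
  have h1 : ∀ ω, S n ω * g ω = ∑ k ∈ Finset.range n, T / n * (X (k * (T / n)) ω * g ω) := by
    intro ω
    simp [hS, Finset.sum_mul, mul_assoc]
  simp_rw [h1]
  rw [integral_finsetSum _ fun k hk => (hH.integrable_mul (hmem n k hk) hg).const_mul _]
  simp_rw [integral_const_mul]

/-- A vector all of whose coordinates belong to a Gaussian space is Gaussian. -/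
theorem isGaussianProcess {T ι : Type*} [Fintype ι] {X : T → Ω → ι → ℝ}
    (hX : ∀ t i, (fun ω => X t ω i) ∈ H) : IsGaussianProcess X P := by
  classical
  refine ⟨fun I => ⟨?_⟩⟩
  have hm : AEMeasurable (fun ω => I.restrict (X · ω)) P := by
    refine aemeasurable_pi_lambda _ fun t => aemeasurable_pi_lambda _ fun i => ?_
    exact (hH.gaussian _ (hX t i)).aemeasurable
  refine isGaussian_of_isGaussian_map fun L => ?_
  rw [AEMeasurable.map_map_of_aemeasurable (by fun_prop) hm]
  refine (hH.gaussian _ ?_).isGaussian_map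
  have hL : (L ∘ fun ω => I.restrict (X · ω)) = ∑ t : I, ∑ i : ι,
      L (Pi.single t (Pi.single i 1)) • fun ω => X t ω i := by
    ext ω
    have hx : I.restrict (X · ω) =
        ∑ t : I, ∑ i : ι, X t ω i • (Pi.single t (Pi.single i 1) : I → ι → ℝ) := by
      ext t i
      simp [Finset.sum_apply, Pi.single_apply, apply_ite, ite_apply]
    simp only [Function.comp_apply]
    rw [hx]
    simp [Finset.sum_apply, mul_comm]
  rw [hL]
  exact H.sum_mem fun t _ => H.sum_mem fun i _ => H.smul_mem _ (hX t i)

/-- Two finite families in a Gaussian space with the same second moments have the same law. -/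
theorem map_eq_map {κ ι : Type*} [Fintype κ] [Fintype ι] {X Y : κ → ι → Ω → ℝ}
    (hX : ∀ a i, X a i ∈ H) (hY : ∀ a i, Y a i ∈ H)
    (hXY : ∀ a i b j, ∫ ω, X a i ω * X b j ω ∂P = ∫ ω, Y a i ω * Y b j ω ∂P) :
    P.map (fun ω a i => X a i ω) = P.map (fun ω a i => Y a i ω) := by
  classical
  have hm : ∀ Z : κ → ι → Ω → ℝ, (∀ a i, Z a i ∈ H) → AEMeasurable (fun ω a i => Z a i ω) P :=
    fun Z hZ => aemeasurable_pi_lambda _ fun a => aemeasurable_pi_lambda _ fun i =>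
      (hH.gaussian _ (hZ a i)).aemeasurable
  have : IsProbabilityMeasure P := (hH.gaussian 0 H.zero_mem).isProbabilityMeasure
  have := P.isProbabilityMeasure_map (hm X hX)
  have := P.isProbabilityMeasure_map (hm Y hY)
  refine Measure.ext_of_charFunDual ?_
  ext L
  -- Every linear functional of the family lies in `H`, so its law is fixed by its variance, a
  -- quadratic expression in the second moments.
  have key : ∀ Z : κ → ι → Ω → ℝ, (hZ : ∀ a i, Z a i ∈ H) →
      charFunDual (P.map fun ω a i => Z a i ω) L = charFun (gaussianReal 0
        (∑ a, ∑ i, ∑ b, ∑ j, L (Pi.single a (Pi.single i 1)) * L (Pi.single b (Pi.single j 1)) *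
          ∫ ω, Z a i ω * Z b j ω ∂P).toNNReal) 1 := by
    intro Z hZ
    have hL : (L ∘ fun ω a i => Z a i ω) = ∑ a, ∑ i,
        L (Pi.single a (Pi.single i 1)) • Z a i := by
      ext ω
      have hx : (fun a i => Z a i ω) =
          ∑ a, ∑ i, Z a i ω • (Pi.single a (Pi.single i 1) : κ → ι → ℝ) := by
        ext t i
        simp [Finset.sum_apply, Pi.single_apply, apply_ite, ite_apply]
      simp only [Function.comp_apply]
      rw [hx]
      simp [Finset.sum_apply, mul_comm]
    have hmemL : (L ∘ fun ω a i => Z a i ω) ∈ H := by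
      rw [hL]
      exact H.sum_mem fun t _ => H.sum_mem fun i _ => H.smul_mem _ (hZ t i)
    rw [charFunDual_eq_charFun_map_one, AEMeasurable.map_map_of_aemeasurable (by fun_prop) (hm Z hZ),
      map_eq_gaussianReal_of_mean_zero (hH.gaussian _ hmemL) (hH.mean _ hmemL)]
    congr 3
    rw [hL]
    have hsq : ∀ ω, (∑ a, ∑ i, L (Pi.single a (Pi.single i 1)) • Z a i) ω ^ 2 =
        ∑ a, ∑ i, ∑ b, ∑ j, L (Pi.single a (Pi.single i 1)) * L (Pi.single b (Pi.single j 1)) *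
          (Z a i ω * Z b j ω) := by
      intro ω
      simp only [Finset.sum_apply, Pi.smul_apply, smul_eq_mul, sq, Finset.sum_mul, Finset.mul_sum]
      congr! 4
      ring
    simp_rw [hsq]
    have hint : ∀ a i b j, Integrable (fun ω => L (Pi.single a (Pi.single i 1)) *
        L (Pi.single b (Pi.single j 1)) * (Z a i ω * Z b j ω)) P := fun a i b j =>
      (hH.integrable_mul (hZ a i) (hZ b j)).const_mul _
    rw [integral_finsetSum _ fun a _ => integrable_finsetSum _ fun i _ => integrable_finsetSum _
      fun b _ => integrable_finsetSum _ fun j _ => hint a i b j]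
    refine Finset.sum_congr rfl fun a _ => ?_
    rw [integral_finsetSum _ fun i _ => integrable_finsetSum _
      fun b _ => integrable_finsetSum _ fun j _ => hint a i b j]
    refine Finset.sum_congr rfl fun i _ => ?_
    rw [integral_finsetSum _ fun b _ => integrable_finsetSum _ fun j _ => hint a i b j]
    refine Finset.sum_congr rfl fun b _ => ?_
    rw [integral_finsetSum _ fun j _ => hint a i b j]
    simp_rw [integral_const_mul]
  rw [key X hX, key Y hY]
  simp_rw [hXY]

end IsGaussianSpace

end GaussianSpace

end CoarseGrain

namespace CoarseGrain

-- Linear Volterra equations and variation of constants.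

section LinearODE

variable {ι κ : Type*} [Fintype ι]

theorem intervalIntegral_pi_apply {f : ℝ → ι → ℝ} {a b : ℝ}
    (hf : IntervalIntegrable f volume a b) (i : ι) :
    (∫ t in a..b, f t) i = ∫ t in a..b, f t i :=
  ((ContinuousLinearMap.proj (R := ℝ) (φ := fun _ : ι => ℝ) i).intervalIntegral_comp_comm hf).symm

theorem intervalIntegral_mulVec [Fintype κ] (A : Matrix κ ι ℝ) {f : ℝ → ι → ℝ} {a b : ℝ}
    (hf : IntervalIntegrable f volume a b) :
    ∫ t in a..b, A *ᵥ f t = A *ᵥ ∫ t in a..b, f t :=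
  (LinearMap.toContinuousLinearMap (Matrix.mulVecLin A)).intervalIntegral_comp_comm hf

theorem continuousOn_mulVec (A : Matrix κ ι ℝ) {f : ℝ → ι → ℝ} {s : Set ℝ} (hf : ContinuousOn f s) :
    ContinuousOn (fun t => A *ᵥ f t) s :=
  (continuous_const.matrix_mulVec continuous_id).comp_continuousOn hf

theorem ContinuousOn.intervalIntegrable_of_nonneg {E : Type*} [NormedAddCommGroup E] {f : ℝ → E}
    (hf : ContinuousOn f (Ici 0)) {t : ℝ} (ht : 0 ≤ t) : IntervalIntegrable f volume 0 t :=
  (hf.mono Icc_subset_Ici_self).intervalIntegrable_of_Icc ht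

/-- Freezing a path at its value at time 0 allows two-sided calculus on the whole line for paths
that matter only for `t ≥ 0`. -/
theorem exists_continuous_extension {E : Type*} [TopologicalSpace E] {f : ℝ → E}
    (hf : ContinuousOn f (Ici 0)) : ∃ g : ℝ → E, Continuous g ∧ ∀ t, 0 ≤ t → g t = f t := by
  refine ⟨fun t => f (max t 0), ?_, fun t ht => by simp [ht]⟩
  exact hf.comp_continuous (by fun_prop) fun t => le_max_right t 0

/-- Uniqueness for linear Volterra equations. -/
theorem volterra_unique (B : Matrix ι ι ℝ) {y₁ y₂ g : ℝ → ι → ℝ} {a b : ℝ}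
    (h₁ : ContinuousOn y₁ (Icc a b)) (h₂ : ContinuousOn y₂ (Icc a b))
    (e₁ : ∀ t ∈ Icc a b, y₁ t = g t + ∫ s in a..t, B *ᵥ y₁ s)
    (e₂ : ∀ t ∈ Icc a b, y₂ t = g t + ∫ s in a..t, B *ᵥ y₂ s) :
    ∀ t ∈ Icc a b, y₁ t = y₂ t := by
  have hc := h₁.sub h₂
  have hcB := continuousOn_mulVec B hc
  have hint : ∀ {y : ℝ → ι → ℝ}, ContinuousOn y (Icc a b) → ∀ t ∈ Icc a b,
      IntervalIntegrable y volume a t := fun hy t ht =>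
    (hy.mono (Icc_subset_Icc_right ht.2)).intervalIntegrable_of_Icc ht.1
  -- The inhomogeneity `g` cancels in the difference, so it may be as rough as a Wiener path;
  -- Gronwall's inequality then applies to a differentiable function.
  have he : ∀ t ∈ Icc a b, y₁ t - y₂ t = ∫ s in a..t, B *ᵥ (y₁ s - y₂ s) := by
    intro t ht
    rw [e₁ t ht, e₂ t ht]
    simp only [Matrix.mulVec_sub]
    rw [intervalIntegral.integral_sub (hint (continuousOn_mulVec B h₁) t ht)
      (hint (continuousOn_mulVec B h₂) t ht)]
    abel
  intro t ht
  rcases ht.1.eq_or_lt with rfl | hat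
  · have := he a ht
    simpa [sub_eq_zero] using this
  have hab : a < b := hat.trans_le ht.2
  set L := LinearMap.toContinuousLinearMap (Matrix.mulVecLin B) with hL
  have := eq_zero_of_abs_deriv_le_mul_abs_self_of_eq_zero_right (K := ‖L‖) (a := a) (b := b)
    (f := fun t => y₁ t - y₂ t) (f' := fun t => B *ᵥ (y₁ t - y₂ t)) hc ?_ ?_ ?_ t ht
  · exact sub_eq_zero.1 this
  · intro x hx
    have hd : HasDerivWithinAt (fun t => ∫ s in a..t, B *ᵥ (y₁ s - y₂ s))
        (B *ᵥ (y₁ x - y₂ x)) (Ici x) x := by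
      have hxb : Icc x b ∈ 𝓝[≥] x := Icc_mem_nhdsGE hx.2
      have hcx : ContinuousWithinAt (fun t => B *ᵥ (y₁ t - y₂ t)) (Icc x b) x :=
        (hcB x ⟨hx.1, hx.2.le⟩).mono (Icc_subset_Icc_left hx.1)
      refine intervalIntegral.integral_hasDerivWithinAt_right (t := Ioi x)
        (hint hcB x ⟨hx.1, hx.2.le⟩) ?_ ?_
      · refine ⟨Icc x b, ?_, ?_⟩
        · exact nhdsWithin_mono _ Ioi_subset_Ici_self hxb
        · exact (hcB.mono (Icc_subset_Icc_left hx.1)).aestronglyMeasurable measurableSet_Icc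
      · have : ContinuousWithinAt (fun t => B *ᵥ (y₁ t - y₂ t)) (Ici x) x :=
          hcx.mono_of_mem_nhdsWithin hxb
        exact this.mono Ioi_subset_Ici_self
    refine hd.congr_of_eventuallyEq ?_ (he x ⟨hx.1, hx.2.le⟩)
    filter_upwards [Icc_mem_nhdsGE hx.2] with s hs
    exact he s ⟨hx.1.trans hs.1, hs.2⟩
  · have := he a ⟨le_rfl, hab.le⟩
    simpa using this
  · intro x _
    exact L.le_opNorm _

variable [DecidableEq ι]

theorem hasDerivAt_exp_smul (B : Matrix ι ι ℝ) (t : ℝ) (i j : ι) :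
    HasDerivAt (fun t : ℝ => (NormedSpace.exp (t • B) : Matrix ι ι ℝ) i j)
      ((B * NormedSpace.exp (t • B)) i j) t := by
  open scoped Matrix.Norms.Operator in
  have h := hasDerivAt_exp_smul_const' (𝕂 := ℝ) B t
  exact ((Matrix.entryLinearMap ℝ ℝ i j).toContinuousLinearMap.hasFDerivAt.comp_hasDerivAt t h)

theorem continuous_exp_smul (B : Matrix ι ι ℝ) :
    Continuous fun t : ℝ => (NormedSpace.exp (t • B) : Matrix ι ι ℝ) :=
  continuous_matrix fun i j =>
    continuous_iff_continuousAt.2 fun t => (hasDerivAt_exp_smul B t i j).continuousAt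

theorem exp_add_smul (B : Matrix ι ι ℝ) (s t : ℝ) :
    (NormedSpace.exp ((s + t) • B) : Matrix ι ι ℝ) =
      NormedSpace.exp (s • B) * NormedSpace.exp (t • B) := by
  rw [add_smul]
  exact Matrix.exp_add_of_commute _ _ (((Commute.refl B).smul_left s).smul_right t)

theorem exp_smul_comm (B : Matrix ι ι ℝ) (t : ℝ) :
    B * (NormedSpace.exp (t • B) : Matrix ι ι ℝ) = NormedSpace.exp (t • B) * B :=
  (((Commute.refl B).smul_right t).exp_right).eq

/-- The solution `e^{tB} (y₀ + ∫₀ᵗ e^{-sB} f(s) ds)` of `y' = B y + f`, `y(0) = y₀`. -/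
noncomputable def duhamel (B : Matrix ι ι ℝ) (y₀ : ι → ℝ) (f : ℝ → ι → ℝ) (t : ℝ) : ι → ℝ :=
  NormedSpace.exp (t • B) *ᵥ (y₀ + ∫ s in (0 : ℝ)..t, NormedSpace.exp ((-s) • B) *ᵥ f s)

theorem continuous_exp_neg_mulVec (B : Matrix ι ι ℝ) {f : ℝ → ι → ℝ} (hf : Continuous f) :
    Continuous fun s : ℝ => (NormedSpace.exp ((-s) • B) : Matrix ι ι ℝ) *ᵥ f s :=
  ((continuous_exp_smul B).comp continuous_neg).matrix_mulVec hf

/-- With `e^{tB}` pulled out of the integral, `t` occurs in the integral only as its upper limit,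
and the product rule with the fundamental theorem of calculus suffices. -/
theorem hasDerivAt_duhamel (B : Matrix ι ι ℝ) (y₀ : ι → ℝ) {f : ℝ → ι → ℝ} (hf : Continuous f)
    (t : ℝ) : HasDerivAt (duhamel B y₀ f) (B *ᵥ duhamel B y₀ f t + f t) t := by
  have hc := continuous_exp_neg_mulVec B hf
  have hk : HasDerivAt (fun t => y₀ + ∫ s in (0 : ℝ)..t, NormedSpace.exp ((-s) • B) *ᵥ f s)
      (NormedSpace.exp ((-t) • B) *ᵥ f t) t :=
    (hc.integral_hasStrictDerivAt 0 t).hasDerivAt.const_add y₀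
  rw [hasDerivAt_pi] at hk ⊢
  intro i
  have h1 := HasDerivAt.fun_sum (u := Finset.univ) fun j _ =>
    (hasDerivAt_exp_smul B t i j).mul (hk j)
  have h2 : (B *ᵥ duhamel B y₀ f t + f t) i = ∑ j, ((B * NormedSpace.exp (t • B)) i j *
      (y₀ + ∫ s in (0 : ℝ)..t, NormedSpace.exp ((-s) • B) *ᵥ f s) j +
      (NormedSpace.exp (t • B) : Matrix ι ι ℝ) i j *
        ((NormedSpace.exp ((-t) • B) : Matrix ι ι ℝ) *ᵥ f t) j) := by
    have h3 : f t = (NormedSpace.exp (t • B) : Matrix ι ι ℝ) *ᵥ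
        ((NormedSpace.exp ((-t) • B) : Matrix ι ι ℝ) *ᵥ f t) := by
      rw [Matrix.mulVec_mulVec, ← exp_add_smul]
      simp
    conv_lhs => rw [h3]
    rw [duhamel, Matrix.mulVec_mulVec, Finset.sum_add_distrib]
    rfl
  rw [h2]
  exact h1

theorem duhamel_zero (B : Matrix ι ι ℝ) (y₀ : ι → ℝ) (f : ℝ → ι → ℝ) : duhamel B y₀ f 0 = y₀ := by
  simp [duhamel]

theorem continuous_duhamel (B : Matrix ι ι ℝ) (y₀ : ι → ℝ) {f : ℝ → ι → ℝ} (hf : Continuous f) :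
    Continuous (duhamel B y₀ f) :=
  continuous_iff_continuousAt.2 fun t => (hasDerivAt_duhamel B y₀ hf t).continuousAt

theorem duhamel_eq_integral (B : Matrix ι ι ℝ) (y₀ : ι → ℝ) {f : ℝ → ι → ℝ} (hf : Continuous f)
    (t : ℝ) : duhamel B y₀ f t = y₀ + ∫ s in (0 : ℝ)..t, (B *ᵥ duhamel B y₀ f s + f s) := by
  rw [intervalIntegral.integral_eq_sub_of_hasDerivAt (f := duhamel B y₀ f)
    (fun s _ => hasDerivAt_duhamel B y₀ hf s), duhamel_zero]
  · abel
  · exact ((continuous_const.matrix_mulVec (continuous_duhamel B y₀ hf)).add hf).intervalIntegrable _ _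

theorem duhamel_eq (B : Matrix ι ι ℝ) (y₀ : ι → ℝ) {f : ℝ → ι → ℝ} (hf : Continuous f) (t : ℝ) :
    duhamel B y₀ f t = NormedSpace.exp (t • B) *ᵥ y₀ +
      ∫ s in (0 : ℝ)..t, NormedSpace.exp ((t - s) • B) *ᵥ f s := by
  rw [duhamel, Matrix.mulVec_add, ← intervalIntegral_mulVec _
    ((continuous_exp_neg_mulVec B hf).intervalIntegrable _ _)]
  simp_rw [Matrix.mulVec_mulVec, ← exp_add_smul, ← sub_eq_add_neg]

theorem duhamel_congr (B : Matrix ι ι ℝ) (y₀ : ι → ℝ) {f g : ℝ → ι → ℝ}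
    (h : ∀ t, 0 ≤ t → f t = g t) {t : ℝ} (ht : 0 ≤ t) : duhamel B y₀ f t = duhamel B y₀ g t := by
  rw [duhamel, duhamel]
  congr 2
  refine intervalIntegral.integral_congr fun s hs => ?_
  rw [uIcc_of_le ht] at hs
  simp only [h s hs.1]

/-- After integration by parts, `y - w` is a classical solution of `u' = B u + B w`, so the rough
path enters only undifferentiated. -/
theorem ouPath_eq_duhamel (B : Matrix ι ι ℝ) (x₀ : ι → ℝ) {w : ℝ → ι → ℝ}
    (hw : ContinuousOn w (Ici 0)) {t : ℝ} (ht : 0 ≤ t) :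
    ouPath B x₀ w t = w t + duhamel B x₀ (fun s => B *ᵥ w s) t := by
  obtain ⟨v, hv, hvw⟩ := exists_continuous_extension hw
  rw [duhamel_congr B x₀ (g := fun s => B *ᵥ v s) (fun s hs => by rw [hvw s hs]) ht,
    duhamel_eq B x₀ (continuous_const.matrix_mulVec hv), ouPath]
  have : ∫ s in (0 : ℝ)..t, (B * NormedSpace.exp ((t - s) • B)) *ᵥ w s =
      ∫ s in (0 : ℝ)..t, (NormedSpace.exp ((t - s) • B)) *ᵥ (B *ᵥ v s) := by
    refine intervalIntegral.integral_congr fun s hs => ?_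
    rw [uIcc_of_le ht] at hs
    simp only [exp_smul_comm, Matrix.mulVec_mulVec, hvw s hs.1]
  rw [this]
  abel

theorem continuousOn_duhamel (B : Matrix ι ι ℝ) (y₀ : ι → ℝ) {f : ℝ → ι → ℝ}
    (hf : ContinuousOn f (Ici 0)) : ContinuousOn (duhamel B y₀ f) (Ici 0) := by
  obtain ⟨g, hg, hgf⟩ := exists_continuous_extension hf
  exact (continuous_duhamel B y₀ hg).continuousOn.congr fun t ht =>
    duhamel_congr B y₀ (fun s hs => (hgf s hs).symm) ht

theorem continuousOn_ouPath (B : Matrix ι ι ℝ) (x₀ : ι → ℝ) {w : ℝ → ι → ℝ}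
    (hw : ContinuousOn w (Ici 0)) : ContinuousOn (ouPath B x₀ w) (Ici 0) :=
  (hw.add (continuousOn_duhamel B x₀ (continuousOn_mulVec B hw))).congr fun _ ht =>
    ouPath_eq_duhamel B x₀ hw ht

/-- Solution of the integrated linear equation `y' = B y + f + w'`. -/
theorem ouPath_add_eq (B : Matrix ι ι ℝ) (x₀ : ι → ℝ) {w f : ℝ → ι → ℝ}
    (hw : ContinuousOn w (Ici 0)) (hf : ContinuousOn f (Ici 0)) {t : ℝ} (ht : 0 ≤ t) :
    ouPath B x₀ w t + duhamel B 0 f t = x₀ +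
      (∫ s in (0 : ℝ)..t, (B *ᵥ (ouPath B x₀ w s + duhamel B 0 f s) + f s)) + w t := by
  obtain ⟨v, hv, hvw⟩ := exists_continuous_extension hw
  obtain ⟨g, hg, hgf⟩ := exists_continuous_extension hf
  have hBv : Continuous fun s => B *ᵥ v s := continuous_const.matrix_mulVec hv
  have e1 : ∀ s, 0 ≤ s → ouPath B x₀ w s = v s + duhamel B x₀ (fun s => B *ᵥ v s) s := by
    intro s hs
    rw [ouPath_eq_duhamel B x₀ hw hs, hvw s hs]
    congr 1
    exact duhamel_congr B x₀ (fun r hr => by rw [hvw r hr]) hs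
  have e2 : ∀ s, 0 ≤ s → duhamel B 0 f s = duhamel B 0 g s := fun s hs =>
    duhamel_congr B 0 (fun r hr => (hgf r hr).symm) hs
  have e3 : ∫ s in (0 : ℝ)..t, (B *ᵥ (ouPath B x₀ w s + duhamel B 0 f s) + f s) =
      (∫ s in (0 : ℝ)..t, (B *ᵥ duhamel B x₀ (fun s => B *ᵥ v s) s + B *ᵥ v s)) +
      ∫ s in (0 : ℝ)..t, (B *ᵥ duhamel B 0 g s + g s) := by
    rw [← intervalIntegral.integral_add]
    · refine intervalIntegral.integral_congr fun s hs => ?_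
      rw [uIcc_of_le ht] at hs
      simp only [e1 s hs.1, e2 s hs.1, Matrix.mulVec_add, hgf s hs.1]
      abel
    · exact ((continuous_const.matrix_mulVec (continuous_duhamel B x₀ hBv)).add
        hBv).intervalIntegrable _ _
    · exact ((continuous_const.matrix_mulVec (continuous_duhamel B 0 hg)).add
        hg).intervalIntegrable _ _
  rw [e3, e1 t ht, e2 t ht]
  conv_lhs => rw [duhamel_eq_integral B x₀ hBv t, duhamel_eq_integral B 0 hg t]
  rw [hvw t ht, zero_add]
  abel

/-- Forcing, noise and initial value are collected into one inhomogeneity; uniqueness for the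
Volterra equation then identifies `y` with the solution already constructed. -/
theorem eq_ouPath_add (B : Matrix ι ι ℝ) (x₀ : ι → ℝ) {w f y : ℝ → ι → ℝ}
    (hw : ContinuousOn w (Ici 0)) (hf : ContinuousOn f (Ici 0)) (hy : ContinuousOn y (Ici 0))
    (h : ∀ t, 0 ≤ t → y t = x₀ + (∫ s in (0 : ℝ)..t, (B *ᵥ y s + f s)) + w t) {t : ℝ}
    (ht : 0 ≤ t) : y t = ouPath B x₀ w t + duhamel B 0 f t := by
  have hY : ContinuousOn (fun t => ouPath B x₀ w t + duhamel B 0 f t) (Ici 0) :=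
    (continuousOn_ouPath B x₀ hw).add (continuousOn_duhamel B 0 hf)
  have hsplit : ∀ {u : ℝ → ι → ℝ}, ContinuousOn u (Ici 0) → ∀ s, 0 ≤ s →
      x₀ + (∫ r in (0 : ℝ)..s, (B *ᵥ u r + f r)) + w s =
        (x₀ + (∫ r in (0 : ℝ)..s, f r) + w s) + ∫ r in (0 : ℝ)..s, B *ᵥ u r := by
    intro u hu s hs
    rw [intervalIntegral.integral_add
      (ContinuousOn.intervalIntegrable_of_nonneg (continuousOn_mulVec B hu) hs)
      (ContinuousOn.intervalIntegrable_of_nonneg hf hs)]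
    abel
  refine volterra_unique B (a := 0) (b := t)
    (g := fun s => x₀ + (∫ r in (0 : ℝ)..s, f r) + w s) (hy.mono Icc_subset_Ici_self)
    (hY.mono Icc_subset_Ici_self) (fun s hs => ?_) (fun s hs => ?_) t ⟨ht, le_rfl⟩
  · rw [← hsplit hy s hs.1, ← h s hs.1]
  · rw [← hsplit hY s hs.1]
    exact ouPath_add_eq B x₀ hw hf hs.1

end LinearODE

end CoarseGrain

namespace CoarseGrain

-- Pathwise equivalence of the second-order model and the generalized Langevin equation.

section Pathwise

variable {N m : ℕ}

theorem LangevinModel.continuous_Feff (M : LangevinModel N m) : Continuous M.Feff := by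
  unfold LangevinModel.Feff
  exact (continuous_const.matrix_mulVec (M.continuous_F.comp
    (continuous_const.matrix_mulVec continuous_id))).sub (continuous_const.matrix_mulVec continuous_id)

/-- The matrix `[C₁; C₀]` through which the momentum drives the auxiliary variables. -/
def Coeffs.input (c : Coeffs m) : Matrix (Fin m ⊕ Fin m) (Fin m) ℝ := Matrix.fromRows c.C1 c.C0

theorem Coeffs.kernel_apply (c : Coeffs m) (t : ℝ) (i j : Fin m) :
    c.kernel t i j =
      ((NormedSpace.exp (t • c.Bhat) : Matrix (Fin m ⊕ Fin m) (Fin m ⊕ Fin m) ℝ) * c.input)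
        (Sum.inr i) j := by
  rw [Coeffs.kernel, Matrix.mul_assoc, Coeffs.input]
  simp [Matrix.mul_apply, Matrix.fromCols, Matrix.one_apply, Fintype.sum_sum_type]

theorem Coeffs.drift_mulVec (c : Coeffs m) (z₁ z p : Fin m → ℝ) :
    c.Bhat *ᵥ Sum.elim z₁ z + c.input *ᵥ p =
      Sum.elim (c.B1 *ᵥ z + c.C1 *ᵥ p) (z₁ + c.B0 *ᵥ z + c.C0 *ᵥ p) := by
  ext (i | i) <;> simp [Coeffs.Bhat, Coeffs.input, Matrix.fromBlocks_mulVec, Matrix.fromRows_mulVec]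

/-- `θ₂` is the lower block of `e^{tB̂} [C₁; C₀]`, so convolving it with `p` is the lower half of
the response from rest. -/
theorem memory_eq_duhamel (c : Coeffs m) {p : ℝ → Fin m → ℝ} (hp : ContinuousOn p (Ici 0)) {t : ℝ}
    (ht : 0 ≤ t) (i : Fin m) :
    memory c.kernel p t i = duhamel c.Bhat 0 (fun s => c.input *ᵥ p s) t (Sum.inr i) := by
  obtain ⟨r, hr, hrp⟩ := exists_continuous_extension hp
  have hf : Continuous fun s => c.input *ᵥ r s := continuous_const.matrix_mulVec hr
  have hE : Continuous fun s : ℝ =>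
      (NormedSpace.exp ((t - s) • c.Bhat) : Matrix (Fin m ⊕ Fin m) (Fin m ⊕ Fin m) ℝ) :=
    (continuous_exp_smul c.Bhat).comp (continuous_const.sub continuous_id)
  have hk : Continuous fun s : ℝ => c.kernel (t - s) := by
    refine continuous_matrix fun i j => ?_
    simp_rw [c.kernel_apply]
    exact (hE.matrix_mul continuous_const).matrix_elem _ _
  rw [duhamel_congr c.Bhat 0 (g := fun s => c.input *ᵥ r s) (fun s hs => by rw [hrp s hs]) ht,
    duhamel_eq _ _ hf, Matrix.mulVec_zero, zero_add, memory,
    intervalIntegral_pi_apply ((hE.matrix_mulVec hf).intervalIntegrable _ _)]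
  have : ∫ τ in (0 : ℝ)..t, c.kernel (t - τ) *ᵥ p τ = ∫ τ in (0 : ℝ)..t, c.kernel (t - τ) *ᵥ r τ := by
    refine intervalIntegral.integral_congr fun s hs => ?_
    rw [uIcc_of_le ht] at hs
    simp only [hrp s hs.1]
  rw [this, intervalIntegral_pi_apply ((hk.matrix_mulVec hr).intervalIntegrable _ _)]
  congr 1
  ext s
  rw [Matrix.mulVec_mulVec]
  simp only [Matrix.mulVec, dotProduct, c.kernel_apply]

theorem continuousOn_memory (c : Coeffs m) {p : ℝ → Fin m → ℝ} (hp : ContinuousOn p (Ici 0)) :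
    ContinuousOn (memory c.kernel p) (Ici 0) := by
  have h := continuousOn_duhamel c.Bhat 0 (continuousOn_mulVec c.input hp)
  rw [continuousOn_pi] at h ⊢
  exact fun i => (h (Sum.inr i)).congr fun t ht => memory_eq_duhamel c hp ht i

/-- The auxiliary variables of the second-order model, in terms of the momentum. -/
theorem SolvesSecondOrder.eq_ouPath {M : LangevinModel N m} {c : Coeffs m} {w₁ : ℝ → Fin m → ℝ}
    {w : ℝ → Fin m ⊕ Fin m → ℝ} {q p z₁ z : ℝ → Fin m → ℝ} (hw : ContinuousOn w (Ici 0))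
    (h : SolvesSecondOrder M c w₁ w q p z₁ z) {t : ℝ} (ht : 0 ≤ t) :
    Sum.elim (z₁ t) (z t) = ouPath c.Bhat (Sum.elim (z₁ 0) (z 0)) w t +
      duhamel c.Bhat 0 (fun s => c.input *ᵥ p s) t := by
  have hy : ContinuousOn (fun t => Sum.elim (z₁ t) (z t)) (Ici 0) := by
    rw [continuousOn_pi]
    rintro (i | i)
    · exact continuousOn_pi.1 h.cont_z₁ i
    · exact continuousOn_pi.1 h.cont_z i
  refine eq_ouPath_add c.Bhat _ hw (continuousOn_mulVec c.input h.cont_p) hy (fun s hs => ?_) ht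
  have hB := (continuousOn_mulVec c.Bhat hy).fun_add (continuousOn_mulVec c.input h.cont_p)
  have h1 := (continuousOn_mulVec c.B1 h.cont_z).fun_add (continuousOn_mulVec c.C1 h.cont_p)
  have h2 := (h.cont_z₁.fun_add (continuousOn_mulVec c.B0 h.cont_z)).fun_add
    (continuousOn_mulVec c.C0 h.cont_p)
  ext i
  simp only [Pi.add_apply]
  rw [intervalIntegral_pi_apply (ContinuousOn.intervalIntegrable_of_nonneg hB hs)]
  simp_rw [c.drift_mulVec]
  rcases i with i | i
  · have := congrFun (h.eq_z₁ s hs) i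
    simp only [Pi.add_apply] at this
    rw [intervalIntegral_pi_apply (ContinuousOn.intervalIntegrable_of_nonneg h1 hs)] at this
    exact this
  · have := congrFun (h.eq_z s hs) i
    simp only [Pi.add_apply] at this
    rw [intervalIntegral_pi_apply (ContinuousOn.intervalIntegrable_of_nonneg h2 hs)] at this
    exact this

theorem SolvesSecondOrder.z_eq {M : LangevinModel N m} {c : Coeffs m} {w₁ : ℝ → Fin m → ℝ}
    {w : ℝ → Fin m ⊕ Fin m → ℝ} {q p z₁ z : ℝ → Fin m → ℝ} (hw : ContinuousOn w (Ici 0))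
    (h : SolvesSecondOrder M c w₁ w q p z₁ z) {t : ℝ} (ht : 0 ≤ t) :
    z t = memory c.kernel p t +
      fun i => ouPath c.Bhat (Sum.elim (z₁ 0) (z 0)) w t (Sum.inr i) := by
  ext i
  have := congrFun (h.eq_ouPath hw ht) (Sum.inr i)
  simp only [Sum.elim_inr, Pi.add_apply] at this
  rw [this, Pi.add_apply, memory_eq_duhamel c h.cont_p ht, add_comm]

/-- Passing the memory variable `z = memory + g` from the force to the noise. -/
theorem momentum_integral_eq (M : LangevinModel N m) (c : Coeffs m) {q p z g : ℝ → Fin m → ℝ}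
    (hq : ContinuousOn q (Ici 0)) (hp : ContinuousOn p (Ici 0)) (hg : ContinuousOn g (Ici 0))
    (hz : ∀ t, 0 ≤ t → z t = memory c.kernel p t + g t) {t : ℝ} (ht : 0 ≤ t) :
    ∫ s in (0 : ℝ)..t, (M.Feff (q s) - M.Γ11 *ᵥ p s - z s) =
      (∫ s in (0 : ℝ)..t, (M.Feff (q s) - M.Γ11 *ᵥ p s - memory c.kernel p s)) -
        ∫ s in (0 : ℝ)..t, g s := by
  have h1 : ContinuousOn (fun s => M.Feff (q s) - M.Γ11 *ᵥ p s - memory c.kernel p s) (Ici 0) :=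
    ((M.continuous_Feff.comp_continuousOn hq).sub (continuousOn_mulVec _ hp)).sub
      (continuousOn_memory c hp)
  rw [← intervalIntegral.integral_sub (ContinuousOn.intervalIntegrable_of_nonneg h1 ht)
    (ContinuousOn.intervalIntegrable_of_nonneg hg ht)]
  refine intervalIntegral.integral_congr fun s hs => ?_
  rw [uIcc_of_le ht] at hs
  simp only [hz s hs.1]
  abel

/-- The second-order model with initial values `x₀` of the auxiliary variables is equivalent to the
generalized Langevin equation. -/
theorem exists_solvesSecondOrder_iff (M : LangevinModel N m) (c : Coeffs m) {w₁ : ℝ → Fin m → ℝ}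
    {w : ℝ → Fin m ⊕ Fin m → ℝ} (hw : ContinuousOn w (Ici 0)) (hw0 : w 0 = 0)
    (x₀ : Fin m ⊕ Fin m → ℝ) (q p : ℝ → Fin m → ℝ) :
    (∃ z₁ z : ℝ → Fin m → ℝ, z₁ 0 = (fun i => x₀ (Sum.inl i)) ∧ z 0 = (fun i => x₀ (Sum.inr i)) ∧
      SolvesSecondOrder M c w₁ w q p z₁ z) ↔
    SolvesGLE M c.kernel
      (fun t => w₁ t - ∫ s in (0 : ℝ)..t, fun i => ouPath c.Bhat x₀ w s (Sum.inr i)) q p := by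
  have hx₀ : Sum.elim (fun i => x₀ (Sum.inl i)) (fun i => x₀ (Sum.inr i)) = x₀ := by
    ext (i | i) <;> rfl
  have hou := continuousOn_ouPath c.Bhat x₀ hw
  have hg : ContinuousOn (fun s i => ouPath c.Bhat x₀ w s (Sum.inr i)) (Ici 0) :=
    continuousOn_pi.2 fun i => continuousOn_pi.1 hou (Sum.inr i)
  constructor
  · rintro ⟨z₁, z, h1, h0, h⟩
    have hz : ∀ t, 0 ≤ t → z t = memory c.kernel p t +
        fun i => ouPath c.Bhat x₀ w t (Sum.inr i) := by
      intro t ht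
      rw [h.z_eq hw ht, h1, h0, hx₀]
    refine ⟨h.cont_q, h.cont_p, h.eq_q, fun t ht => ?_⟩
    rw [h.eq_p t ht, momentum_integral_eq M c h.cont_q h.cont_p hg hz ht]
    abel
  · intro h
    have hf := continuousOn_mulVec c.input h.cont_p
    -- The auxiliary variables are the two halves of the variation-of-constants path driven by the
    -- given `p`.
    set y : ℝ → Fin m ⊕ Fin m → ℝ := fun t => ouPath c.Bhat x₀ w t +
      duhamel c.Bhat 0 (fun s => c.input *ᵥ p s) t with hy
    have hyc : ContinuousOn y (Ici 0) := hou.add (continuousOn_duhamel c.Bhat 0 hf)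
    have hy0 : y 0 = x₀ := by simp [hy, ouPath, duhamel_zero, hw0]
    have hye : ∀ t, y t = Sum.elim (fun i => y t (Sum.inl i)) (fun i => y t (Sum.inr i)) := by
      intro t; ext (i | i) <;> rfl
    have hyeq : ∀ t, 0 ≤ t → y t = y 0 + (∫ s in (0 : ℝ)..t,
        Sum.elim (c.B1 *ᵥ (fun i => y s (Sum.inr i)) + c.C1 *ᵥ p s)
          ((fun i => y s (Sum.inl i)) + c.B0 *ᵥ (fun i => y s (Sum.inr i)) + c.C0 *ᵥ p s)) + w t := by
      intro t ht
      rw [hy0]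
      simp_rw [← c.drift_mulVec, ← hye]
      exact ouPath_add_eq c.Bhat x₀ hw hf ht
    have hint : ContinuousOn (fun s => Sum.elim (c.B1 *ᵥ (fun i => y s (Sum.inr i)) + c.C1 *ᵥ p s)
        ((fun i => y s (Sum.inl i)) + c.B0 *ᵥ (fun i => y s (Sum.inr i)) + c.C0 *ᵥ p s)) (Ici 0) := by
      simp_rw [← c.drift_mulVec, ← hye]
      exact (continuousOn_mulVec c.Bhat hyc).add hf
    have hc1 : ContinuousOn (fun t i => y t (Sum.inl i)) (Ici 0) :=
      continuousOn_pi.2 fun i => continuousOn_pi.1 hyc (Sum.inl i)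
    have hc2 : ContinuousOn (fun t i => y t (Sum.inr i)) (Ici 0) :=
      continuousOn_pi.2 fun i => continuousOn_pi.1 hyc (Sum.inr i)
    refine ⟨fun t i => y t (Sum.inl i), fun t i => y t (Sum.inr i), by simp [hy0], by simp [hy0],
      h.cont_q, h.cont_p, hc1, hc2, h.eq_q, fun t ht => ?_, fun t ht => ?_, fun t ht => ?_⟩
    · rw [momentum_integral_eq M c h.cont_q h.cont_p hg (fun s hs => ?_) ht, h.eq_p t ht]
      · abel
      · ext i
        simp only [hy, Pi.add_apply, memory_eq_duhamel c h.cont_p hs, add_comm]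
    · ext i
      have := congrFun (hyeq t ht) (Sum.inl i)
      simp only [Pi.add_apply] at this ⊢
      rw [intervalIntegral_pi_apply (ContinuousOn.intervalIntegrable_of_nonneg hint ht)] at this
      rw [intervalIntegral_pi_apply (ContinuousOn.intervalIntegrable_of_nonneg
        ((continuousOn_mulVec c.B1 hc2).fun_add (continuousOn_mulVec c.C1 h.cont_p)) ht)]
      exact this
    · ext i
      have := congrFun (hyeq t ht) (Sum.inr i)
      simp only [Pi.add_apply] at this ⊢
      rw [intervalIntegral_pi_apply (ContinuousOn.intervalIntegrable_of_nonneg hint ht)] at this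
      rw [intervalIntegral_pi_apply (ContinuousOn.intervalIntegrable_of_nonneg
        ((hc1.fun_add (continuousOn_mulVec c.B0 hc2)).fun_add (continuousOn_mulVec c.C0 h.cont_p)) ht)]
      exact this

end Pathwise

end CoarseGrain

namespace CoarseGrain

-- Laplace transforms of matrix exponentials.

section LaplaceTransform

variable {ι : Type*} [Fintype ι] [DecidableEq ι]

/-- Exponential growth bound for the entries of a matrix exponential. -/
theorem exists_abs_exp_smul_le (X : Matrix ι ι ℝ) :
    ∃ K : ℝ, 0 ≤ K ∧ ∀ t, 0 ≤ t → ∀ i j,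
      |(NormedSpace.exp (t • X) : Matrix ι ι ℝ) i j| ≤ Real.exp (K * t) := by
  set L := LinearMap.toContinuousLinearMap (Matrix.mulVecLin X) with hL
  refine ⟨‖L‖, norm_nonneg _, fun t ht i j => ?_⟩
  -- A column of `e^{tX}` solves `y' = X y` from a unit vector, so Gronwall in the sup norm bounds
  -- each entry by `e^{Kt}` without a prefactor.
  set y : ℝ → ι → ℝ := fun t i => (NormedSpace.exp (t • X) : Matrix ι ι ℝ) i j with hy
  have hd : ∀ t, HasDerivAt y (X *ᵥ y t) t := fun t =>
    hasDerivAt_pi.2 fun i => hasDerivAt_exp_smul X t i j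
  have h0 : ‖y 0‖ ≤ 1 := by
    refine (pi_norm_le_iff_of_nonneg zero_le_one).2 fun i => ?_
    simp only [hy, zero_smul, NormedSpace.exp_zero, Matrix.one_apply]
    split_ifs <;> simp
  have := norm_le_gronwallBound_of_norm_deriv_right_le (f := y) (f' := fun t => X *ᵥ y t)
    (δ := 1) (K := ‖L‖) (ε := 0) (a := 0) (b := t)
    (fun s _ => (hd s).continuousAt.continuousWithinAt) (fun s _ => (hd s).hasDerivWithinAt) h0
    (fun s _ => (L.le_opNorm (y s)).trans_eq (add_zero _).symm) t ⟨ht, le_rfl⟩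
  rw [gronwallBound_ε0, one_mul, sub_zero] at this
  exact (norm_le_pi_norm (y t) i).trans this

/-- The resolvent formula for the Laplace transform of a matrix exponential. -/
theorem laplace_exp (X : Matrix ι ι ℝ) : ∀ᶠ lam in 𝓝[>] (0 : ℝ),
    (∀ i j, IntegrableOn (fun t => (NormedSpace.exp (t • X) : Matrix ι ι ℝ) i j *
      Real.exp (-t / lam)) (Ioi 0)) ∧ IsUnit (1 - lam • X) ∧
    (Matrix.of fun i j => ∫ t in Ioi (0 : ℝ), (NormedSpace.exp (t • X) : Matrix ι ι ℝ) i j *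
      Real.exp (-t / lam)) = lam • (1 - lam • X)⁻¹ := by
  obtain ⟨K, hK, hb⟩ := exists_abs_exp_smul_le X
  have hev : ∀ᶠ lam in 𝓝[>] (0 : ℝ), lam * K < 1 := by
    have : Tendsto (fun lam : ℝ => lam * K) (𝓝 0) (𝓝 (0 * K)) := tendsto_id.mul_const K
    rw [zero_mul] at this
    exact nhdsWithin_le_nhds (this.eventually (gt_mem_nhds one_pos))
  filter_upwards [hev, self_mem_nhdsWithin] with lam hlam hpos
  have hpos : 0 < lam := hpos
  have hrate : 0 < 1 / lam - K := by
    rw [sub_pos, lt_div_iff₀ hpos]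
    linarith
  set F : ι → ι → ℝ → ℝ := fun i j t =>
    (NormedSpace.exp (t • X) : Matrix ι ι ℝ) i j * Real.exp (-t / lam) with hF
  have hbF : ∀ i j t, 0 ≤ t → |F i j t| ≤ Real.exp (-(1 / lam - K) * t) := by
    intro i j t ht
    rw [hF, abs_mul, abs_of_pos (Real.exp_pos _)]
    calc _ ≤ Real.exp (K * t) * Real.exp (-t / lam) := by gcongr; exact hb t ht i j
      _ = _ := by rw [← Real.exp_add]; congr 1; ring
  have hcF : ∀ i j, Continuous (F i j) := fun i j =>
    ((continuous_exp_smul X).matrix_elem i j).mul (by fun_prop)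
  have hint : ∀ i j, IntegrableOn (F i j) (Ioi 0) := fun i j => by
    refine Integrable.mono' (integrableOn_exp_mul_Ioi (neg_lt_zero.2 hrate) 0)
      (hcF i j).aestronglyMeasurable ?_
    filter_upwards [ae_restrict_mem measurableSet_Ioi] with t ht
    exact hbF i j t (le_of_lt ht)
  have hlim : ∀ i j, Tendsto (F i j) atTop (𝓝 0) := by
    intro i j
    refine squeeze_zero_norm' (a := fun t => Real.exp (-(1 / lam - K) * t)) ?_ ?_
    · filter_upwards [eventually_ge_atTop 0] with t ht using hbF i j t ht
    · have h1 : Tendsto (fun t : ℝ => (1 / lam - K) * t) atTop atTop :=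
        tendsto_id.const_mul_atTop hrate
      refine (Real.tendsto_exp_neg_atTop_nhds_zero.comp h1).congr fun t => ?_
      simp only [Function.comp, neg_mul]
  set J : Matrix ι ι ℝ := Matrix.of fun i j => ∫ t in Ioi (0 : ℝ), F i j t with hJ
  -- Integrating `F' = X F - F / lam` over the half-line gives `-1 = X J - J / lam`. The one-sided
  -- inverse so obtained suffices, the matrices being square.
  have hkey : (1 - lam • X) * (lam⁻¹ • J) = 1 := by
    ext i j
    have hd : ∀ t, HasDerivAt (F i j) ((∑ k, X i k * F k j t) - 1 / lam * F i j t) t := by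
      intro t
      have h1 : HasDerivAt (fun t : ℝ => Real.exp (-t / lam)) (Real.exp (-t / lam) * (-1 / lam)) t :=
        ((hasDerivAt_id t).neg.div_const lam).exp
      refine HasDerivAt.congr_deriv ((hasDerivAt_exp_smul X t i j).mul h1) ?_
      simp only [hF, Matrix.mul_apply, Finset.sum_mul]
      rw [sub_eq_add_neg]
      congr 1
      · exact Finset.sum_congr rfl fun k _ => by ring
      · ring
    have hi : IntegrableOn (fun t => (∑ k, X i k * F k j t) - 1 / lam * F i j t) (Ioi 0) :=
      (integrable_finsetSum _ fun k _ => (hint k j).const_mul _).sub ((hint i j).const_mul _)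
    have h2 := integral_Ioi_of_hasDerivAt_of_tendsto' (fun t _ => hd t) hi (hlim i j)
    rw [integral_sub (integrable_finsetSum _ fun k _ => (hint k j).const_mul _)
      ((hint i j).const_mul _), integral_finsetSum _ fun k _ => (hint k j).const_mul _] at h2
    simp_rw [integral_const_mul] at h2
    have h3 : F i j 0 = (1 : Matrix ι ι ℝ) i j := by simp [hF]
    rw [h3] at h2
    have h4 : (X * J) i j = ∑ k, X i k * ∫ t in Ioi (0 : ℝ), F k j t := rfl
    have h5 : J i j = ∫ t in Ioi (0 : ℝ), F i j t := rfl
    rw [← h4, ← h5] at h2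
    rw [sub_mul, one_mul, smul_mul_smul_comm, Matrix.sub_apply, Matrix.smul_apply,
      Matrix.smul_apply, mul_inv_cancel₀ hpos.ne', one_smul, smul_eq_mul]
    rw [one_div] at h2
    linarith
  refine ⟨hint, ?_, ?_⟩
  · exact (Matrix.isUnit_iff_isUnit_det _).2 (Matrix.isUnit_det_of_right_inverse hkey)
  · rw [Matrix.inv_eq_right_inv hkey, smul_smul, mul_inv_cancel₀ hpos.ne', one_smul]

variable {m : ℕ}

/-- The exact kernel (`X = -G`) and the approximate kernel (`X = B̂`) both have this form. -/
theorem laplace_of_exp (L : Matrix (Fin m) ι ℝ) (X : Matrix ι ι ℝ) (R : Matrix ι (Fin m) ℝ) :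
    ∀ᶠ lam in 𝓝[>] (0 : ℝ),
    (∀ i j, IntegrableOn (fun t => (L * NormedSpace.exp (t • X) * R) i j *
      Real.exp (-t / lam)) (Ioi 0)) ∧ IsUnit (1 - lam • X) ∧
    laplace (fun t => L * NormedSpace.exp (t • X) * R) lam = lam • (L * (1 - lam • X)⁻¹ * R) := by
  filter_upwards [laplace_exp X] with lam h
  obtain ⟨hint, hu, hJ⟩ := h
  have hexp : ∀ i j t, (L * NormedSpace.exp (t • X) * R) i j * Real.exp (-t / lam) =
      ∑ b, ∑ a, L i a * R b j * ((NormedSpace.exp (t • X) : Matrix ι ι ℝ) a b *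
        Real.exp (-t / lam)) := by
    intro i j t
    simp only [Matrix.mul_apply, Finset.sum_mul]
    exact Finset.sum_congr rfl fun b _ => Finset.sum_congr rfl fun a _ => by ring
  have hi : ∀ i j b a, IntegrableOn (fun t => L i a * R b j *
      ((NormedSpace.exp (t • X) : Matrix ι ι ℝ) a b * Real.exp (-t / lam))) (Ioi 0) :=
    fun i j b a => (hint a b).const_mul _
  refine ⟨fun i j => ?_, hu, ?_⟩
  · simp_rw [hexp]
    exact integrable_finsetSum _ fun b _ => integrable_finsetSum _ fun a _ => hi i j b a
  · rw [← Matrix.smul_mul, ← Matrix.mul_smul, ← hJ]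
    ext i j
    simp only [laplace, Matrix.of_apply, hexp]
    rw [integral_finsetSum _ fun b _ => integrable_finsetSum _ fun a _ => hi i j b a]
    simp only [Matrix.mul_apply, Finset.sum_mul, Matrix.of_apply]
    refine Finset.sum_congr rfl fun b _ => ?_
    rw [integral_finsetSum _ fun a _ => hi i j b a]
    refine Finset.sum_congr rfl fun a _ => ?_
    rw [integral_const_mul]
    ring

theorem iteratedDeriv_exp (L : Matrix (Fin m) ι ℝ) (X : Matrix ι ι ℝ) (R : Matrix ι (Fin m) ℝ)
    (l : ℕ) (i j : Fin m) :
    iteratedDeriv l (fun t : ℝ => (L * NormedSpace.exp (t • X) * R) i j) =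
      fun t : ℝ => (L * X ^ l * NormedSpace.exp (t • X) * R) i j := by
  induction l with
  | zero => simp
  | succ l ih =>
    rw [iteratedDeriv_succ, ih]
    ext t
    refine HasDerivAt.deriv ?_
    have h1 := HasDerivAt.fun_sum (u := Finset.univ) fun b _ =>
      (HasDerivAt.fun_sum (u := Finset.univ) fun a _ =>
        (hasDerivAt_exp_smul X t a b).const_mul ((L * X ^ l) i a)).mul_const (R b j)
    have h2 : (L * X ^ (l + 1) * NormedSpace.exp (t • X) * R) i j =
        ∑ b, (∑ a, (L * X ^ l) i a * (X * NormedSpace.exp (t • X)) a b) * R b j := by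
      rw [pow_succ, ← Matrix.mul_assoc, Matrix.mul_assoc (L * X ^ l) X]
      rfl
    rw [h2]
    exact h1

/-- A vanishing third-order expansion has vanishing coefficients. -/
theorem coeff_eq_zero_of_tendsto {A₁ A₂ A₃ G₀ : Matrix (Fin m) (Fin m) ℝ}
    {G : ℝ → Matrix (Fin m) (Fin m) ℝ} (hG : Tendsto G (𝓝[>] 0) (𝓝 G₀))
    (h : Tendsto (fun lam : ℝ => (lam ^ 3)⁻¹ • (lam • A₁ + lam ^ 2 • A₂ + lam ^ 3 • A₃ +
      lam ^ 4 • G lam)) (𝓝[>] 0) (𝓝 0)) : A₁ = 0 ∧ A₂ = 0 ∧ A₃ = 0 := by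
  have hid : Tendsto (fun lam : ℝ => lam) (𝓝[>] 0) (𝓝 0) := tendsto_id.mono_left nhdsWithin_le_nhds
  have hne : ∀ᶠ lam in 𝓝[>] (0 : ℝ), lam ≠ 0 := by
    filter_upwards [self_mem_nhdsWithin] with lam hlam using (ne_of_gt hlam)
  have h1 : A₁ = 0 := by
    -- Multiplying by `lam ^ 2` isolates `A₁` in the limit, which must be 0; then one factor `lam`
    -- isolates `A₂`, and none is needed for `A₃`.
    have ha := (hid.pow 2).smul h
    have hb : Tendsto (fun lam : ℝ => A₁ + lam • A₂ + lam ^ 2 • A₃ + lam ^ 3 • G lam) (𝓝[>] 0)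
        (𝓝 (A₁ + (0 : ℝ) • A₂ + (0 : ℝ) ^ 2 • A₃ + (0 : ℝ) ^ 3 • G₀)) :=
      ((tendsto_const_nhds.add (hid.smul_const A₂)).add ((hid.pow 2).smul_const A₃)).add
        ((hid.pow 3).smul hG)
    have hc := tendsto_nhds_unique_of_eventuallyEq hb ha (by
      filter_upwards [hne] with lam hlam
      simp only [smul_add, smul_smul]
      congr 4 <;> (rw [eq_comm]; field_simp)
      rw [← one_smul ℝ A₁, smul_smul]
      congr 1
      field_simp)
    simpa using hc
  subst h1
  have h2 : A₂ = 0 := by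
    have ha := hid.smul h
    have hb : Tendsto (fun lam : ℝ => A₂ + lam • A₃ + lam ^ 2 • G lam) (𝓝[>] 0)
        (𝓝 (A₂ + (0 : ℝ) • A₃ + (0 : ℝ) ^ 2 • G₀)) :=
      (tendsto_const_nhds.add (hid.smul_const A₃)).add ((hid.pow 2).smul hG)
    have hc := tendsto_nhds_unique_of_eventuallyEq hb ha (by
      filter_upwards [hne] with lam hlam
      simp only [smul_add, smul_smul, smul_zero, zero_add]
      congr 3 <;> (rw [eq_comm]; field_simp)
      rw [← one_smul ℝ A₂, smul_smul]
      congr 1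
      field_simp)
    simpa using hc
  subst h2
  refine ⟨rfl, rfl, ?_⟩
  have hb : Tendsto (fun lam : ℝ => A₃ + lam • G lam) (𝓝[>] 0) (𝓝 (A₃ + (0 : ℝ) • G₀)) :=
    tendsto_const_nhds.add (hid.smul hG)
  have hc := tendsto_nhds_unique_of_eventuallyEq hb h (by
    filter_upwards [hne] with lam hlam
    simp only [smul_add, smul_smul, smul_zero, zero_add]
    congr 2 <;> (rw [eq_comm]; field_simp)
    rw [← one_smul ℝ A₃, smul_smul]
    congr 1
    field_simp)
  simpa using hc

end LaplaceTransform

end CoarseGrain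

namespace CoarseGrain

-- The moment equations at zero and at infinity.

section Moments

variable {N m : ℕ}

/-- The right factor of the exact memory kernel. -/
noncomputable def LangevinModel.input (M : LangevinModel N m) :
    Matrix (Fin (3 * N - m) ⊕ Fin (3 * N - m)) (Fin m) ℝ :=
  (Matrix.fromBlocks M.A22⁻¹ 0 0 (-1) :
      Matrix (Fin (3 * N - m) ⊕ Fin (3 * N - m)) (Fin (3 * N - m) ⊕ Fin (3 * N - m)) ℝ) *
    Matrix.fromRows M.A21 M.Γ21

theorem LangevinModel.kernel_eq (M : LangevinModel N m) :
    M.kernel = fun t => Matrix.fromCols M.A12 M.Γ12 * NormedSpace.exp (t • (-M.G)) * M.input := by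
  ext1 t
  rw [LangevinModel.kernel, LangevinModel.input, Matrix.mul_assoc _ (Matrix.fromBlocks _ _ _ _)]

theorem LangevinModel.kernelDeriv_eq (M : LangevinModel N m) (l : ℕ) :
    M.kernelDeriv l = Matrix.fromCols M.A12 M.Γ12 * (-M.G) ^ l * M.input := by
  ext i j
  rw [LangevinModel.kernelDeriv, Matrix.of_apply, M.kernel_eq, iteratedDeriv_exp]
  simp

/-- Cramer's rule: the determinant and the adjugate are continuous, and the determinant tends to 1.
-/
theorem tendsto_inv_one_sub_smul {ι : Type*} [Fintype ι] [DecidableEq ι] (X : Matrix ι ι ℝ) :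
    Tendsto (fun lam : ℝ => (1 - lam • X)⁻¹) (𝓝[>] 0) (𝓝 1) := by
  have hc : Continuous fun lam : ℝ => (1 : Matrix ι ι ℝ) - lam • X :=
    continuous_const.sub (continuous_id.smul continuous_const)
  have hdet := (hc.matrix_det.tendsto 0).mono_left (nhdsWithin_le_nhds (s := Ioi 0))
  have hadj := (hc.matrix_adjugate.tendsto 0).mono_left (nhdsWithin_le_nhds (s := Ioi 0))
  simp only [zero_smul, sub_zero, Matrix.det_one, Matrix.adjugate_one] at hdet hadj
  have := (hdet.inv₀ one_ne_zero).smul hadj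
  simpa [Matrix.inv_def, Ring.inverse_eq_inv'] using this

namespace Coeffs

variable (c : Coeffs m)

/-- The denominator `I - lam B₀ - lam² B₁`. -/
noncomputable def denom (lam : ℝ) : Matrix (Fin m) (Fin m) ℝ := 1 - lam • c.B0 - lam ^ 2 • c.B1

theorem continuous_denom : Continuous c.denom := by
  unfold denom
  fun_prop

theorem eventually_isUnit_denom_zero : ∀ᶠ lam in 𝓝[>] (0 : ℝ), IsUnit (c.denom lam) := by
  have h : Tendsto (fun lam => (c.denom lam).det) (𝓝 0) (𝓝 1) := by
    have := c.continuous_denom.matrix_det.tendsto 0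
    simpa [denom] using this
  filter_upwards [nhdsWithin_le_nhds (h.eventually_ne one_ne_zero)] with lam hlam
  exact (Matrix.isUnit_iff_isUnit_det _).2 (isUnit_iff_ne_zero.2 hlam)

/-- `B₁` may be singular, so the leading term does not decide. But the determinant is a polynomial
in `lam` with value 1 at 0, hence has finitely many roots. -/
theorem eventually_isUnit_denom_atTop : ∀ᶠ lam in atTop, IsUnit (c.denom lam) := by
  set p : Polynomial ℝ := (1 - (Polynomial.X : Polynomial ℝ) • c.B0.map Polynomial.C -
    (Polynomial.X : Polynomial ℝ) ^ 2 • c.B1.map Polynomial.C).det with hp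
  have heval : ∀ lam, p.eval lam = (c.denom lam).det := by
    intro lam
    rw [hp, ← Polynomial.coe_evalRingHom, RingHom.map_det]
    congr 1
    ext i j
    simp [denom, Matrix.one_apply, apply_ite, mul_comm (c.B0 i j), mul_comm (c.B1 i j)]
  have hp0 : p ≠ 0 := by
    intro h
    have := heval 0
    simp [h, denom] at this
  filter_upwards [p.eventually_atTop_not_isRoot hp0] with lam hlam
  refine (Matrix.isUnit_iff_isUnit_det _).2 (isUnit_iff_ne_zero.2 ?_)
  rw [← heval]
  exact hlam

theorem denom_mul_R22 {lam : ℝ} (h : IsUnit (c.denom lam)) :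
    c.denom lam * c.R22 lam = lam • c.C0 + lam ^ 2 • c.C1 := by
  rw [R22, ← Matrix.mul_assoc]
  have := Matrix.mul_nonsing_inv (c.denom lam) ((Matrix.isUnit_iff_isUnit_det _).1 h)
  rw [denom] at this ⊢
  rw [this, Matrix.one_mul]

theorem kernel_eq : c.kernel = fun t => Matrix.fromCols (0 : Matrix (Fin m) (Fin m) ℝ)
    (1 : Matrix (Fin m) (Fin m) ℝ) *
    (NormedSpace.exp (t • c.Bhat) : Matrix (Fin m ⊕ Fin m) (Fin m ⊕ Fin m) ℝ) * c.input := rfl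

/-- The rational function is the Laplace transform of the approximate kernel. -/
theorem laplace_kernel : ∀ᶠ lam in 𝓝[>] (0 : ℝ),
    (∀ i j, IntegrableOn (fun t => c.kernel t i j * Real.exp (-t / lam)) (Ioi 0)) ∧
      laplace c.kernel lam = c.R22 lam := by
  rw [kernel_eq]
  set S : Matrix (Fin m) (Fin m ⊕ Fin m) ℝ :=
    Matrix.fromCols (0 : Matrix (Fin m) (Fin m) ℝ) (1 : Matrix (Fin m) (Fin m) ℝ) with hS
  filter_upwards [laplace_of_exp S c.Bhat c.input,
    c.eventually_isUnit_denom_zero] with lam h hu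
  refine ⟨h.1, ?_⟩
  rw [h.2.2]
  -- The row `[lam I, I]` eliminates the first block column of `1 - lam B̂` and leaves the
  -- denominator in the second; it is thus the denominator times the lower row of the resolvent.
  set S' : Matrix (Fin m) (Fin m ⊕ Fin m) ℝ :=
    Matrix.fromCols (lam • (1 : Matrix (Fin m) (Fin m) ℝ)) (1 : Matrix (Fin m) (Fin m) ℝ) with hS'
  have hrow : S' * (1 - lam • c.Bhat) = c.denom lam * S := by
    have : (1 - lam • c.Bhat) =
        Matrix.fromBlocks 1 (-(lam • c.B1)) (-(lam • 1)) (1 - lam • c.B0) := by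
      rw [Bhat, ← Matrix.fromBlocks_one, Matrix.fromBlocks_smul, sub_eq_add_neg, Matrix.fromBlocks_neg,
        Matrix.fromBlocks_add]
      simp [sub_eq_add_neg]
    rw [this, hS', hS, Matrix.fromCols_mul_fromBlocks, Matrix.mul_fromCols, denom]
    congr 1
    · simp
    · simp only [Matrix.mul_neg, Matrix.one_mul, Matrix.mul_one, Matrix.smul_mul, smul_smul]
      rw [pow_two]
      abel
  have hinv := Matrix.mul_nonsing_inv (1 - lam • c.Bhat) ((Matrix.isUnit_iff_isUnit_det _).1 h.2.1)
  have hmul : c.denom lam * (lam • (S * (1 - lam • c.Bhat)⁻¹ * c.input)) = c.denom lam * c.R22 lam := by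
    rw [c.denom_mul_R22 hu, Matrix.mul_smul, ← Matrix.mul_assoc, ← Matrix.mul_assoc, ← hrow,
      Matrix.mul_assoc _ (1 - lam • c.Bhat), hinv, Matrix.mul_one, input, hS',
      Matrix.fromCols_mul_fromRows]
    simp only [Matrix.smul_mul, Matrix.one_mul, smul_add, smul_smul]
    rw [pow_two, add_comm]
  exact hu.mul_left_cancel hmul

/-- The moment equations at `lam = 0`. -/
theorem moments_at_zero {ι : Type*} [Fintype ι] [DecidableEq ι] (L : Matrix (Fin m) ι ℝ)
    (X : Matrix ι ι ℝ) (R : Matrix ι (Fin m) ℝ)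
    (h : ∀ i j, (fun lam : ℝ => laplace (fun t => L * NormedSpace.exp (t • X) * R) lam i j -
      c.R22 lam i j) =o[𝓝[>] (0 : ℝ)] fun lam : ℝ => lam ^ 3) :
    c.C0 = L * R ∧ c.C1 + c.B0 * (L * R) = L * X * R ∧
      c.B0 * (L * X * R) + c.B1 * (L * R) = L * X ^ 2 * R := by
  set E : ℝ → Matrix (Fin m) (Fin m) ℝ := fun lam =>
    laplace (fun t => L * NormedSpace.exp (t • X) * R) lam - c.R22 lam with hE
  have hE0 : Tendsto (fun lam => (lam ^ 3)⁻¹ • E lam) (𝓝[>] 0) (𝓝 0) := by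
    refine tendsto_pi_nhds.2 fun i => tendsto_pi_nhds.2 fun j => ?_
    refine (h i j).tendsto_div_nhds_zero.congr fun lam => ?_
    simp [hE, div_eq_inv_mul]
  have hden : Tendsto c.denom (𝓝[>] 0) (𝓝 1) := by
    have := (c.continuous_denom.tendsto 0).mono_left (nhdsWithin_le_nhds (s := Ioi 0))
    simpa [denom] using this
  -- Multiplying by the denominator makes the rational part polynomial; as the denominator tends to
  -- `I`, the error stays `o(lam³)`.
  have hDE := hden.mul hE0
  rw [mul_zero] at hDE
  have hinv := tendsto_inv_one_sub_smul X
  -- These are all terms of order four and higher, divided by `lam ^ 4`: the resolvent remainder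
  -- times the denominator, and the products of `B₀`, `B₁` with the lower coefficients.
  have hG : Tendsto (fun lam : ℝ => c.denom lam * (L * X ^ 3 * (1 - lam • X)⁻¹ * R) -
      (c.B0 * (L * X ^ 2 * R) + c.B1 * (L * X * R) + lam • (c.B1 * (L * X ^ 2 * R)))) (𝓝[>] 0)
      (𝓝 ((1 : Matrix (Fin m) (Fin m) ℝ) * (L * X ^ 3 * (1 : Matrix ι ι ℝ) * R) - (c.B0 * (L * X ^ 2 * R) + c.B1 * (L * X * R) +
        (0 : ℝ) • (c.B1 * (L * X ^ 2 * R))))) := by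
    refine (hden.mul ?_).sub (tendsto_const_nhds.add
      ((tendsto_id.mono_left nhdsWithin_le_nhds).smul_const _))
    have hcont : Continuous fun Z : Matrix ι ι ℝ => L * X ^ 3 * Z * R :=
      (continuous_const.matrix_mul continuous_id).matrix_mul continuous_const
    exact (hcont.tendsto 1).comp hinv
  have hmain := coeff_eq_zero_of_tendsto (A₁ := L * R - c.C0)
    (A₂ := L * X * R - c.B0 * (L * R) - c.C1)
    (A₃ := L * X ^ 2 * R - c.B0 * (L * X * R) - c.B1 * (L * R)) hG (hDE.congr' ?_)
  · obtain ⟨h1, h2, h3⟩ := hmain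
    refine ⟨(sub_eq_zero.1 h1).symm, ?_, ?_⟩
    · rw [sub_eq_zero] at h2
      rw [← h2]
      abel
    · rw [sub_sub, sub_eq_zero] at h3
      exact h3.symm
  · filter_upwards [c.eventually_isUnit_denom_zero, laplace_of_exp L X R] with lam hu hl
    obtain ⟨-, hX, hl⟩ := hl
    have hgeo : (1 - lam • X)⁻¹ = 1 + lam • X + lam ^ 2 • X ^ 2 + lam ^ 3 • (X ^ 3 * (1 - lam • X)⁻¹) := by
      have hXi := Matrix.mul_nonsing_inv (1 - lam • X) ((Matrix.isUnit_iff_isUnit_det _).1 hX)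
      have hpoly : (1 + lam • X + lam ^ 2 • X ^ 2) * (1 - lam • X) + lam ^ 3 • X ^ 3 = 1 := by
        simp only [mul_sub, add_mul, mul_one, one_mul, smul_mul_smul_comm, ← pow_succ, ← pow_two,
          smul_pow]
        abel
      calc (1 - lam • X)⁻¹ = ((1 + lam • X + lam ^ 2 • X ^ 2) * (1 - lam • X) + lam ^ 3 • X ^ 3) *
            (1 - lam • X)⁻¹ := by rw [hpoly, one_mul]
        _ = _ := by rw [add_mul, mul_assoc, hXi, mul_one, smul_mul_assoc]
    have hL : laplace (fun t => L * NormedSpace.exp (t • X) * R) lam =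
        lam • (L * R) + lam ^ 2 • (L * X * R) + lam ^ 3 • (L * X ^ 2 * R) +
          lam ^ 4 • (L * X ^ 3 * (1 - lam • X)⁻¹ * R) := by
      rw [hl]
      conv_lhs => rw [hgeo]
      simp only [Matrix.mul_add, Matrix.add_mul, Matrix.mul_one, Matrix.mul_smul, Matrix.smul_mul,
        smul_add, smul_smul, Matrix.mul_assoc]
      congr 2 <;> ring_nf
    rw [Matrix.mul_smul]
    congr 1
    simp only [hE, mul_sub]
    rw [c.denom_mul_R22 hu, hL]
    generalize L * X ^ 3 * (1 - lam • X)⁻¹ * R = Y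
    generalize L * X ^ 2 * R = Y2
    generalize L * X * R = Y1
    generalize L * R = Y0
    simp only [denom, sub_mul, one_mul, mul_add, smul_mul_assoc, mul_smul_comm]
    module

/-- The moment equation at `lam = ∞`. -/
theorem moment_at_infty {K : ℝ → Matrix (Fin m) (Fin m) ℝ}
    (hK : ∀ i j, IntegrableOn (fun t => K t i j) (Ioi 0))
    (h : Tendsto (fun lam : ℝ => laplace K lam - c.R22 lam) atTop (𝓝 0)) :
    c.C1 = -(c.B1 * Matrix.of fun i j => ∫ t in Ioi (0 : ℝ), K t i j) := by
  set J : Matrix (Fin m) (Fin m) ℝ := Matrix.of fun i j => ∫ t in Ioi (0 : ℝ), K t i j with hJ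
  have hlap : Tendsto (laplace K) atTop (𝓝 J) := by
    refine tendsto_pi_nhds.2 fun i => tendsto_pi_nhds.2 fun j => ?_
    simp only [laplace, hJ, Matrix.of_apply]
    refine tendsto_integral_filter_of_dominated_convergence (fun t => ‖K t i j‖) ?_ ?_
      (hK i j).norm ?_
    · refine Eventually.of_forall fun lam => ?_
      exact (hK i j).aestronglyMeasurable.mul
        (by fun_prop : Continuous fun t : ℝ => Real.exp (-t / lam)).aestronglyMeasurable
    · filter_upwards [eventually_gt_atTop 0] with lam hlam
      filter_upwards [ae_restrict_mem measurableSet_Ioi] with t ht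
      rw [norm_mul]
      refine mul_le_of_le_one_right (norm_nonneg _) ?_
      rw [Real.norm_of_nonneg (Real.exp_pos _).le, Real.exp_le_one_iff]
      exact div_nonpos_of_nonpos_of_nonneg (neg_nonpos.2 (le_of_lt ht)) hlam.le
    · refine ae_of_all _ fun t => ?_
      have h1 : Tendsto (fun lam : ℝ => -t / lam) atTop (𝓝 0) := tendsto_const_nhds.div_atTop tendsto_id
      have h2 := ((Real.continuous_exp.tendsto 0).comp h1).const_mul (K t i j)
      simpa using h2
  have hR : Tendsto c.R22 atTop (𝓝 J) := by
    have := hlap.sub h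
    simpa using this
  have hi : Tendsto (fun lam : ℝ => lam⁻¹) atTop (𝓝 0) := tendsto_inv_atTop_zero
  -- Dividing denominator and numerator by `lam ^ 2` leaves `-B₁` and `C₁`. The relation denominator
  -- times `R₂₂` equals numerator is passed to the limit, so `B₁` need not be invertible.
  have hD : Tendsto (fun lam : ℝ => (lam ^ 2)⁻¹ • c.denom lam) atTop (𝓝 (-c.B1)) := by
    have h1 : Tendsto (fun lam : ℝ => lam⁻¹ ^ 2 • (1 : Matrix (Fin m) (Fin m) ℝ) - lam⁻¹ • c.B0 - c.B1)
        atTop (𝓝 ((0 : ℝ) ^ 2 • (1 : Matrix (Fin m) (Fin m) ℝ) - (0 : ℝ) • c.B0 - c.B1)) :=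
      (((hi.pow 2).smul_const _).sub (hi.smul_const _)).sub_const _
    have h2 := h1.congr' (f₂ := fun lam : ℝ => (lam ^ 2)⁻¹ • c.denom lam) (by
      filter_upwards [eventually_gt_atTop 0] with lam hlam
      simp only [denom, smul_sub, smul_smul]
      rw [inv_pow, inv_mul_cancel₀ (by positivity), one_smul]
      congr 3
      field_simp)
    simpa using h2
  have hN : Tendsto (fun lam : ℝ => (lam ^ 2)⁻¹ • (lam • c.C0 + lam ^ 2 • c.C1)) atTop (𝓝 c.C1) := by
    have h1 : Tendsto (fun lam : ℝ => lam⁻¹ • c.C0 + c.C1) atTop (𝓝 ((0 : ℝ) • c.C0 + c.C1)) :=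
      (hi.smul_const _).add_const _
    have h2 := h1.congr' (f₂ := fun lam : ℝ => (lam ^ 2)⁻¹ • (lam • c.C0 + lam ^ 2 • c.C1)) (by
      filter_upwards [eventually_gt_atTop 0] with lam hlam
      simp only [smul_add, smul_smul]
      rw [inv_mul_cancel₀ (by positivity), one_smul]
      congr 2
      field_simp)
    simpa using h2
  have := tendsto_nhds_unique_of_eventuallyEq (hD.mul hR) hN (by
    filter_upwards [c.eventually_isUnit_denom_atTop] with lam hu
    rw [Matrix.smul_mul, c.denom_mul_R22 hu])
  rw [← this, Matrix.neg_mul]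

end Coeffs

end Moments

end CoarseGrain

namespace CoarseGrain

-- A common Gaussian space for the independent data.

section IndependentFamilies

variable {Ω T ι : Type*}

/-- The real random variables that are measurable functions of `V`. -/
def factorsThrough {𝓥 : Type*} [MeasurableSpace 𝓥] (V : Ω → 𝓥) : Submodule ℝ (Ω → ℝ) where
  carrier := {f | ∃ φ : 𝓥 → ℝ, Measurable φ ∧ f = φ ∘ V}
  add_mem' := by
    rintro _ _ ⟨φ, hφ, rfl⟩ ⟨ψ, hψ, rfl⟩
    exact ⟨φ + ψ, hφ.add hψ, rfl⟩
  zero_mem' := ⟨0, measurable_const, rfl⟩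
  smul_mem' := by
    rintro c _ ⟨φ, hφ, rfl⟩
    exact ⟨c • φ, hφ.const_smul c, rfl⟩

/-- The linear span of the coordinates of a vector-valued process. -/
def processSpan (X : T → Ω → ι → ℝ) : Submodule ℝ (Ω → ℝ) :=
  Submodule.span ℝ (range fun (p : T × ι) ω => X p.1 ω p.2)

theorem mem_processSpan (X : T → Ω → ι → ℝ) (t : T) (i : ι) :
    (fun ω => X t ω i) ∈ processSpan X :=
  Submodule.subset_span ⟨(t, i), rfl⟩

theorem processSpan_le_factorsThrough (X : T → Ω → ι → ℝ) :
    processSpan X ≤ factorsThrough fun ω t => X t ω := by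
  refine Submodule.span_le.2 ?_
  rintro _ ⟨p, rfl⟩
  exact ⟨fun v => v p.1 p.2, by fun_prop, rfl⟩

variable [MeasurableSpace Ω] {P : Measure Ω}

theorem indepFun_of_factorsThrough {𝓥₁ 𝓥₂ : Type*} [MeasurableSpace 𝓥₁] [MeasurableSpace 𝓥₂]
    {V₁ : Ω → 𝓥₁} {V₂ : Ω → 𝓥₂} (hV : IndepFun V₁ V₂ P) {f g : Ω → ℝ}
    (hf : f ∈ factorsThrough V₁) (hg : g ∈ factorsThrough V₂) : IndepFun f g P := by
  obtain ⟨φ, hφ, rfl⟩ := hf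
  obtain ⟨ψ, hψ, rfl⟩ := hg
  exact hV.comp hφ hψ

/-- Independence supplies joint Gaussianity; Gaussian marginals alone would not make the sums
Gaussian. -/
theorem gaussian_sup_of_indep {H₁ H₂ : Submodule ℝ (Ω → ℝ)}
    (h₁ : ∀ f ∈ H₁, HasGaussianLaw f P ∧ ∫ ω, f ω ∂P = 0)
    (h₂ : ∀ f ∈ H₂, HasGaussianLaw f P ∧ ∫ ω, f ω ∂P = 0)
    (h : ∀ f ∈ H₁, ∀ g ∈ H₂, IndepFun f g P) :
    ∀ f ∈ H₁ ⊔ H₂, HasGaussianLaw f P ∧ ∫ ω, f ω ∂P = 0 := by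
  intro f hf
  obtain ⟨a, ha, b, hb, rfl⟩ := Submodule.mem_sup.1 hf
  have hga := (h₁ a ha).1
  have hgb := (h₂ b hb).1
  refine ⟨((h a ha b hb).hasGaussianLaw hga hgb).add, ?_⟩
  simp only [Pi.add_apply]
  rw [integral_add hga.integrable hgb.integrable, (h₁ a ha).2, (h₂ b hb).2, add_zero]

theorem gaussian_processSpan [Fintype ι] {X : T → Ω → ι → ℝ} (hX : IsGaussianProcess X P)
    (h0 : ∀ t i, ∫ ω, X t ω i ∂P = 0) :
    ∀ f ∈ processSpan X, HasGaussianLaw f P ∧ ∫ ω, f ω ∂P = 0 := by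
  classical
  intro f hf
  obtain ⟨c, rfl⟩ := Finsupp.mem_span_range_iff_exists_finsupp.1 hf
  have hint : ∀ t i, Integrable (fun ω => X t ω i) P := fun t i =>
    ((hX.hasGaussianLaw_eval t).map_fun (ContinuousLinearMap.proj (R := ℝ) i)).integrable
  have hsum : (c.sum fun p a => a • fun ω => X p.1 ω p.2) =
      fun ω => ∑ p ∈ c.support, c p * X p.1 ω p.2 := by
    ext ω
    simp [Finsupp.sum, Finset.sum_apply]
  rw [hsum]
  constructor
  · set I := c.support.image Prod.fst with hI
    let L : (I → ι → ℝ) →L[ℝ] ℝ := ∑ p : c.support, c p •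
      (ContinuousLinearMap.proj (R := ℝ) (φ := fun _ : ι => ℝ) p.1.2).comp
        (ContinuousLinearMap.proj (R := ℝ) (φ := fun _ : I => ι → ℝ)
          ⟨p.1.1, Finset.mem_image_of_mem _ p.2⟩)
    have hL : (fun ω => ∑ p ∈ c.support, c p * X p.1 ω p.2) = fun ω => L (I.restrict (X · ω)) := by
      ext ω
      rw [← Finset.sum_coe_sort]
      simp [L]
    rw [hL]
    exact (hX.hasGaussianLaw I).map_fun L
  · rw [integral_finsetSum _ fun p _ => (hint _ _).const_mul _]
    simp [integral_const_mul, h0]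

theorem integral_mul_eq_zero_of_indep {f g : Ω → ℝ} (hfg : IndepFun f g P)
    (hf : HasGaussianLaw f P) (hg : HasGaussianLaw g P) (hf0 : ∫ ω, f ω ∂P = 0) :
    ∫ ω, f ω * g ω ∂P = 0 := by
  rw [hfg.integral_fun_mul_eq_mul_integral hf.aemeasurable.aestronglyMeasurable
    hg.aemeasurable.aestronglyMeasurable, hf0, zero_mul]

/-- The initial values and the driving Wiener processes live in a common Gaussian space, and are
mutually uncorrelated. -/
theorem exists_gaussianSpace_of_indep {ι₁ ι₂ : Type*} [Fintype ι₁] [Fintype ι₂]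
    {C S : Matrix ι₁ ι₁ ℝ} {S₁ : Matrix ι₂ ι₂ ℝ}
    {Z₀ : Ω → ι₁ → ℝ} {W : ℝ → Ω → ι₁ → ℝ} {W₁ : ℝ → Ω → ι₂ → ℝ}
    (hZ₀ : IsCenteredGaussian P C Z₀) (hW : IsWiener P S W) (hW₁ : IsWiener P S₁ W₁)
    (hind : IndepFun Z₀ (fun ω (t : ℝ≥0) => W t ω) P)
    (hind₁ : IndepFun (fun ω => (Z₀ ω, fun t : ℝ≥0 => W t ω)) (fun ω (t : ℝ≥0) => W₁ t ω) P) :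
    ∃ H : Submodule ℝ (Ω → ℝ), IsGaussianSpace P H ∧
      (∀ i, (fun ω => Z₀ ω i) ∈ H) ∧ (∀ t, 0 ≤ t → ∀ i, (fun ω => W t ω i) ∈ H) ∧
      (∀ t, 0 ≤ t → ∀ i, (fun ω => W₁ t ω i) ∈ H) ∧
      (∀ t, 0 ≤ t → ∀ i j, ∫ ω, W t ω i * Z₀ ω j ∂P = 0) ∧
      (∀ t, 0 ≤ t → ∀ i j, ∫ ω, Z₀ ω i * W₁ t ω j ∂P = 0) ∧
      (∀ s t, 0 ≤ s → 0 ≤ t → ∀ i j, ∫ ω, W s ω i * W₁ t ω j ∂P = 0) := by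
  have hZp : IsGaussianProcess (fun _ : Unit => Z₀) P :=
    ⟨fun I => hZ₀.gaussian.map_fun (ContinuousLinearMap.pi fun _ : I => ContinuousLinearMap.id ℝ _)⟩
  set HZ := processSpan (fun _ : Unit => Z₀)
  set HW := processSpan (fun t : ℝ≥0 => W t)
  set HW₁ := processSpan (fun t : ℝ≥0 => W₁ t)
  have gZ := gaussian_processSpan hZp fun _ i => hZ₀.mean i
  have gW := gaussian_processSpan hW.gaussian fun t i => hW.mean t t.2 i
  have gW₁ := gaussian_processSpan hW₁.gaussian fun t i => hW₁.mean t t.2 i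
  have fZ' : HZ ≤ factorsThrough Z₀ := by
    refine (processSpan_le_factorsThrough _).trans ?_
    rintro _ ⟨φ, hφ, rfl⟩
    exact ⟨fun z => φ fun _ => z, hφ.comp (by fun_prop), rfl⟩
  have fW' := processSpan_le_factorsThrough (fun t : ℝ≥0 => W t)
  have fW₁ := processSpan_le_factorsThrough (fun t : ℝ≥0 => W₁ t)
  have hZW : ∀ f ∈ HZ, ∀ g ∈ HW, IndepFun f g P := fun f hf g hg =>
    indepFun_of_factorsThrough hind (fZ' hf) (fW' hg)
  have fZW : HZ ⊔ HW ≤ factorsThrough fun ω => (Z₀ ω, fun t : ℝ≥0 => W t ω) := by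
    refine sup_le (fun f hf => ?_) (fun f hf => ?_)
    · obtain ⟨φ, hφ, rfl⟩ := fZ' hf
      exact ⟨fun z => φ z.1, hφ.comp measurable_fst, rfl⟩
    · obtain ⟨φ, hφ, rfl⟩ := fW' hf
      exact ⟨fun z => φ z.2, hφ.comp measurable_snd, rfl⟩
  have hZWW : ∀ f ∈ HZ ⊔ HW, ∀ g ∈ HW₁, IndepFun f g P := fun f hf g hg =>
    indepFun_of_factorsThrough hind₁ (fZW hf) (fW₁ hg)
  have gZW := gaussian_sup_of_indep gZ gW hZW
  -- Closing up preserves Gaussianity; of the independence, only the vanishing correlations of the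
  -- generators are carried further.
  obtain ⟨H, hle, hH⟩ := exists_isGaussianSpace _ (gaussian_sup_of_indep gZW gW₁ hZWW)
  have mZ : ∀ i, (fun ω => Z₀ ω i) ∈ HZ := fun i => mem_processSpan (fun _ : Unit => Z₀) () i
  have mW : ∀ t, 0 ≤ t → ∀ i, (fun ω => W t ω i) ∈ HW := fun t ht i =>
    mem_processSpan (fun t : ℝ≥0 => W t) ⟨t, ht⟩ i
  have mW₁ : ∀ t, 0 ≤ t → ∀ i, (fun ω => W₁ t ω i) ∈ HW₁ := fun t ht i =>
    mem_processSpan (fun t : ℝ≥0 => W₁ t) ⟨t, ht⟩ i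
  refine ⟨H, hH, fun i => hle (le_sup_left (a := HZ ⊔ HW) (le_sup_left (a := HZ) (mZ i))),
    fun t ht i => hle (le_sup_left (a := HZ ⊔ HW) (le_sup_right (a := HZ) (mW t ht i))),
    fun t ht i => hle (le_sup_right (a := HZ ⊔ HW) (mW₁ t ht i)), ?_, ?_, ?_⟩
  · intro t ht i j
    exact integral_mul_eq_zero_of_indep (hZW _ (mZ j) _ (mW t ht i)).symm (gW _ (mW t ht i)).1
      (gZ _ (mZ j)).1 (gW _ (mW t ht i)).2
  · intro t ht i j
    exact integral_mul_eq_zero_of_indep (hZWW _ (le_sup_left (a := HZ) (mZ i)) _ (mW₁ t ht j))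
      (gZ _ (mZ i)).1 (gW₁ _ (mW₁ t ht j)).1 (gZ _ (mZ i)).2
  · intro s t hs ht i j
    exact integral_mul_eq_zero_of_indep
      (hZWW _ (le_sup_right (a := HZ) (mW s hs i)) _ (mW₁ t ht j))
      (gW _ (mW s hs i)).1 (gW₁ _ (mW₁ t ht j)).1 (gW _ (mW s hs i)).2

end IndependentFamilies

end CoarseGrain

namespace CoarseGrain

-- Second moments of the Ornstein-Uhlenbeck process.

section OrnsteinUhlenbeck

variable {Ω ι : Type*} [Fintype ι] [DecidableEq ι] [MeasurableSpace Ω] {P : Measure Ω}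
  {H : Submodule ℝ (Ω → ℝ)} {Z₀ : Ω → ι → ℝ} {W : ℝ → Ω → ι → ℝ}

/-- In the integrated-by-parts form the path is a linear combination of `Z₀`, `W t` and one time
integral of continuous paths, all of which stay in `H`. -/
theorem ouPath_mem (hH : IsGaussianSpace P H) (hZ : ∀ i, (fun ω => Z₀ ω i) ∈ H)
    (hW : ∀ t, 0 ≤ t → ∀ i, (fun ω => W t ω i) ∈ H)
    (hWc : ∀ᵐ ω ∂P, ContinuousOn (fun t => W t ω) (Ici 0)) (B : Matrix ι ι ℝ) {t : ℝ}
    (ht : 0 ≤ t) (i : ι) : (fun ω => ouPath B (Z₀ ω) (fun s => W s ω) t i) ∈ H := by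
  set K : ℝ → Matrix ι ι ℝ := fun s => B * NormedSpace.exp ((t - s) • B) with hK
  have hKc : Continuous K := continuous_const.matrix_mul
    ((continuous_exp_smul B).comp (continuous_const.sub continuous_id))
  have h1 : (fun ω => ∫ s in (0 : ℝ)..t, ∑ j, K s i j * W s ω j) ∈ H := by
    refine (hH.integral_mem (X := fun s ω => ∑ j, K s i j * W s ω j) ht (fun s hs => ?_) ?_).1
    · have : (fun ω => ∑ j, K s i j * W s ω j) = ∑ j, K s i j • fun ω => W s ω j := by
        ext ω
        simp [Finset.sum_apply]
      rw [this]
      exact H.sum_mem fun j _ => H.smul_mem _ (hW s hs.1 j)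
    · filter_upwards [hWc] with ω hω
      exact continuousOn_finsetSum _ fun j _ => (hKc.matrix_elem i j).continuousOn.mul
        ((continuousOn_pi.1 hω j).mono Icc_subset_Ici_self)
  have h2 : (∑ j, (NormedSpace.exp (t • B) : Matrix ι ι ℝ) i j • fun ω => Z₀ ω j) ∈ H :=
    H.sum_mem fun j _ => H.smul_mem _ (hZ j)
  refine hH.congr_ae (H.add_mem h2 (H.add_mem (hW t ht i) h1)) ?_
  filter_upwards [hWc] with ω hω
  have hint : IntervalIntegrable (fun s => K s *ᵥ W s ω) volume 0 t := by
    refine ContinuousOn.intervalIntegrable_of_nonneg ?_ ht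
    exact continuousOn_pi.2 fun k => continuousOn_finsetSum _ fun j _ =>
      (hKc.matrix_elem k j).continuousOn.mul (continuousOn_pi.1 hω j)
  simp only [ouPath, Pi.add_apply, Finset.sum_apply, Pi.smul_apply, smul_eq_mul]
  rw [intervalIntegral_pi_apply hint]
  rfl

/-- The integrated equation for the second moments of the Ornstein-Uhlenbeck process against a
fixed element of the Gaussian space. -/
theorem ouPath_moment_eq (hH : IsGaussianSpace P H) (hZ : ∀ i, (fun ω => Z₀ ω i) ∈ H)
    (hW : ∀ t, 0 ≤ t → ∀ i, (fun ω => W t ω i) ∈ H)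
    (hWc : ∀ᵐ ω ∂P, ContinuousOn (fun t => W t ω) (Ici 0)) (B : Matrix ι ι ℝ) {X : Ω → ℝ}
    (hX : X ∈ H) :
    ContinuousOn (fun t i => ∫ ω, ouPath B (Z₀ ω) (fun s => W s ω) t i * X ω ∂P) (Ici 0) ∧
    ∀ t, 0 ≤ t → (fun i => ∫ ω, ouPath B (Z₀ ω) (fun s => W s ω) t i * X ω ∂P) =
      ((fun i => ∫ ω, Z₀ ω i * X ω ∂P) + fun i => ∫ ω, W t ω i * X ω ∂P) +
        ∫ s in (0 : ℝ)..t, B *ᵥ fun i => ∫ ω, ouPath B (Z₀ ω) (fun s => W s ω) s i * X ω ∂P := by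
  set Y : ℝ → ι → Ω → ℝ := fun t i ω => ouPath B (Z₀ ω) (fun s => W s ω) t i with hY
  have hYm : ∀ t, 0 ≤ t → ∀ i, Y t i ∈ H := fun t ht i => ouPath_mem hH hZ hW hWc B ht i
  have hYc : ∀ᵐ ω ∂P, ∀ i, ContinuousOn (fun t => Y t i ω) (Ici 0) := by
    filter_upwards [hWc] with ω hω i
    exact continuousOn_pi.1 (continuousOn_ouPath B (Z₀ ω) hω) i
  have hcont : ContinuousOn (fun t i => ∫ ω, Y t i ω * X ω ∂P) (Ici 0) := by
    refine continuousOn_pi.2 fun i => ?_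
    refine hH.continuousOn_integral_mul (X := fun t => Y t i) (fun t ht => hYm t ht i) ?_ hX
    filter_upwards [hYc] with ω hω using hω i
  refine ⟨hcont, fun t ht => ?_⟩
  ext i
  have hsum : ∀ s, (fun ω => ∑ j, B i j * Y s j ω) = ∑ j, B i j • Y s j := by
    intro s
    ext ω
    simp [Finset.sum_apply]
  have hI := hH.integral_mem (X := fun s ω => ∑ j, B i j * Y s j ω) ht (fun s hs => by
      simp only [hsum]
      exact H.sum_mem fun j _ => H.smul_mem _ (hYm s hs.1 j)) (by
      filter_upwards [hYc] with ω hω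
      exact continuousOn_finsetSum _ fun j _ => continuousOn_const.mul
        ((hω j).mono Icc_subset_Ici_self))
  have heq : ∀ᵐ ω ∂P, Y t i ω * X ω = Z₀ ω i * X ω + W t ω i * X ω +
      (∫ s in (0 : ℝ)..t, ∑ j, B i j * Y s j ω) * X ω := by
    filter_upwards [hWc] with ω hω
    have h0 : ∀ s, duhamel B (0 : ι → ℝ) (fun _ => 0) s = 0 := fun s => by simp [duhamel]
    have h1 := congrFun (ouPath_add_eq B (Z₀ ω) hω (f := fun _ => 0) continuousOn_const ht) i
    simp only [h0, add_zero, Pi.add_apply, Pi.zero_apply] at h1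
    rw [intervalIntegral_pi_apply (ContinuousOn.intervalIntegrable_of_nonneg
      (continuousOn_mulVec B (continuousOn_ouPath B (Z₀ ω) hω)) ht)] at h1
    have h2 : Y t i ω = Z₀ ω i + (∫ s in (0 : ℝ)..t, ∑ j, B i j * Y s j ω) + W t ω i := h1
    rw [h2]
    ring
  simp only [Pi.add_apply]
  rw [integral_congr_ae heq, integral_add
    ((hH.integrable_mul (hZ i) hX).fun_add (hH.integrable_mul (hW t ht i) hX))
    (hH.integrable_mul hI.1 hX), integral_add (hH.integrable_mul (hZ i) hX)
    (hH.integrable_mul (hW t ht i) hX), hI.2 X hX,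
    intervalIntegral_pi_apply (ContinuousOn.intervalIntegrable_of_nonneg
      (continuousOn_mulVec B hcont) ht)]
  congr 1
  refine intervalIntegral.integral_congr fun s hs => ?_
  rw [uIcc_of_le ht] at hs
  simp only [Finset.sum_mul, Matrix.mulVec, dotProduct]
  rw [integral_finsetSum]
  · simp_rw [mul_assoc, integral_const_mul]
  · intro j _
    simp_rw [mul_assoc]
    exact (hH.integrable_mul (hYm s hs.1 j) hX).const_mul _

/-- Correlation of the Ornstein-Uhlenbeck process with its initial value. -/
theorem ouPath_moment_init (hH : IsGaussianSpace P H) (hZ : ∀ i, (fun ω => Z₀ ω i) ∈ H)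
    (hW : ∀ t, 0 ≤ t → ∀ i, (fun ω => W t ω i) ∈ H)
    (hWc : ∀ᵐ ω ∂P, ContinuousOn (fun t => W t ω) (Ici 0)) (B : Matrix ι ι ℝ)
    {C : Matrix ι ι ℝ} (hC : ∀ i j, ∫ ω, Z₀ ω i * Z₀ ω j ∂P = C i j)
    (hWZ : ∀ t, 0 ≤ t → ∀ i j, ∫ ω, W t ω i * Z₀ ω j ∂P = 0) {t : ℝ} (ht : 0 ≤ t) (i j : ι) :
    ∫ ω, ouPath B (Z₀ ω) (fun s => W s ω) t i * Z₀ ω j ∂P = (NormedSpace.exp (t • B) * C) i j := by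
  obtain ⟨hc, he⟩ := ouPath_moment_eq hH hZ hW hWc B (hZ j)
  have hd := continuous_duhamel B (fun i => C i j) (f := fun _ => 0) continuous_const
  have := volterra_unique B (g := fun _ i => C i j) (hc.mono Icc_subset_Ici_self)
    (hd.continuousOn (s := Icc 0 t)) (fun s hs => ?_) (fun s hs => ?_) t ⟨ht, le_rfl⟩
  · rw [congrFun this i]
    simp [duhamel, Matrix.mulVec, dotProduct, Matrix.mul_apply]
  · rw [he s hs.1]
    congr 1
    ext i
    simp only [Pi.add_apply]
    rw [hC, hWZ s hs.1, add_zero]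
  · have := duhamel_eq_integral B (fun i => C i j) (f := fun _ => 0) continuous_const s
    simpa using this

/-- The correlation is differentiated in the earlier time, with `B` placed next to `C` as the
Lyapunov equation requires. -/
theorem hasDerivAt_exp_sub (B C : Matrix ι ι ℝ) (s t : ℝ) (i j : ι) :
    HasDerivAt (fun t : ℝ => ((NormedSpace.exp ((s - t) • B) : Matrix ι ι ℝ) * C) i j)
      (-((NormedSpace.exp ((s - t) • B) : Matrix ι ι ℝ) * (B * C)) i j) t := by
  have h1 : ∀ k, HasDerivAt (fun t : ℝ => (NormedSpace.exp ((s - t) • B) : Matrix ι ι ℝ) i k)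
      (-(NormedSpace.exp ((s - t) • B) * B : Matrix ι ι ℝ) i k) t := by
    intro k
    have := (hasDerivAt_exp_smul B (s - t) i k).comp_const_sub s t
    rw [exp_smul_comm] at this
    exact this
  have h2 := HasDerivAt.fun_sum (u := Finset.univ) fun k _ => (h1 k).mul_const (C k j)
  refine h2.congr_deriv ?_
  rw [← Matrix.mul_assoc, Matrix.mul_apply (M := NormedSpace.exp ((s - t) • B) * B)]
  simp

/-- Correlation of the Ornstein-Uhlenbeck process with the past of the driving Wiener process. -/
theorem ouPath_moment_noise (hH : IsGaussianSpace P H) (hZ : ∀ i, (fun ω => Z₀ ω i) ∈ H)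
    (hW : ∀ t, 0 ≤ t → ∀ i, (fun ω => W t ω i) ∈ H)
    (hWc : ∀ᵐ ω ∂P, ContinuousOn (fun t => W t ω) (Ici 0)) (B : Matrix ι ι ℝ)
    {S : Matrix ι ι ℝ}
    (hS : ∀ s t, 0 ≤ s → 0 ≤ t → ∀ i j, ∫ ω, W s ω i * W t ω j ∂P = min s t * S i j)
    (hWZ : ∀ t, 0 ≤ t → ∀ i j, ∫ ω, W t ω i * Z₀ ω j ∂P = 0) {s t : ℝ} (hs : 0 ≤ s) (hst : s ≤ t)
    (i j : ι) :
    ∫ ω, ouPath B (Z₀ ω) (fun s => W s ω) t i * W s ω j ∂P =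
      ∫ u in (0 : ℝ)..s, (NormedSpace.exp ((t - u) • B) * S) i j := by
  obtain ⟨hc, he⟩ := ouPath_moment_eq hH hZ hW hWc B (hW s hs j)
  set r : ℝ → ι → ℝ := fun t i => ∫ ω, ouPath B (Z₀ ω) (fun s => W s ω) t i * W s ω j ∂P with hr
  have hd := continuous_duhamel B 0 (f := fun _ i => S i j) continuous_const
  have he' : ∀ t, 0 ≤ t → r t = (min t s • fun i => S i j) + ∫ u in (0 : ℝ)..t, B *ᵥ r u := by
    intro t ht
    refine (he t ht).trans ?_
    congr 1
    ext i
    simp only [Pi.add_apply, Pi.smul_apply, smul_eq_mul]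
    rw [hS t s ht hs]
    simp_rw [mul_comm (Z₀ _ i)]
    rw [hWZ s hs, zero_add]
  -- The covariance `min t s • S` of the driving noise acts as a constant forcing `S` up to time `s`
  -- and is frozen afterwards. So `r` solves a forced equation on `[0, s]` and then evolves freely
  -- from `r s` on `[s, t]`.
  have hpast := volterra_unique B (g := fun t => min t s • fun i => S i j)
    (hc.mono Icc_subset_Ici_self) (hd.continuousOn (s := Icc 0 s)) (fun u hu => he' u hu.1)
    (fun u hu => by
      have hdB : Continuous fun v => B *ᵥ duhamel B 0 (fun _ i => S i j) v :=
        continuous_const.matrix_mulVec hd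
      rw [duhamel_eq_integral B 0 (f := fun _ i => S i j) continuous_const u,
        intervalIntegral.integral_add (hdB.intervalIntegrable _ _) (by simp)]
      simp [min_eq_left hu.2, add_comm])
  have hd' := continuous_duhamel B (r s) (f := fun _ => 0) continuous_const
  have hfut := volterra_unique B (a := s) (b := t) (g := fun _ => r s)
    (y₂ := fun v => duhamel B (r s) (fun _ => 0) (v - s))
    (hc.mono (Icc_subset_Ici_self.trans (Ici_subset_Ici.2 hs)))
    (hd'.comp (continuous_id.sub continuous_const)).continuousOn (fun u hu => by
      rw [he' u (hs.trans hu.1), he' s hs, min_self, min_eq_right hu.1, add_assoc,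
        intervalIntegral.integral_add_adjacent_intervals]
      · exact ContinuousOn.intervalIntegrable_of_nonneg (continuousOn_mulVec B hc) hs
      · exact ((continuousOn_mulVec B hc).mono
          (Icc_subset_Ici_self.trans (Ici_subset_Ici.2 hs))).intervalIntegrable_of_Icc hu.1)
    (fun u _ => by
      rw [duhamel_eq_integral B (r s) (f := fun _ => 0) continuous_const (u - s)]
      simp only [add_zero]
      rw [intervalIntegral.integral_comp_sub_right (fun v => B *ᵥ duhamel B (r s) (fun _ => 0) v) s,
        sub_self])
    t ⟨hst, le_rfl⟩
  have h1 : r t = NormedSpace.exp ((t - s) • B) *ᵥ r s := by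
    have : r t = duhamel B (r s) (fun _ => 0) (t - s) := hfut
    rw [this]
    simp [duhamel]
  have h2 : r s = duhamel B 0 (fun _ i => S i j) s := hpast s ⟨hs, le_rfl⟩
  change r t i = _
  have hc2 := continuous_exp_neg_mulVec B (f := fun _ i => S i j) continuous_const
  have hc3 : Continuous fun u : ℝ => (NormedSpace.exp (t • B) : Matrix ι ι ℝ) *ᵥ
      ((NormedSpace.exp ((-u) • B) : Matrix ι ι ℝ) *ᵥ fun i => S i j) :=
    continuous_const.matrix_mulVec hc2
  rw [h1, h2, duhamel, Matrix.mulVec_mulVec, ← exp_add_smul, sub_add_cancel, zero_add,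
    ← intervalIntegral_mulVec _ (hc2.intervalIntegrable _ _),
    intervalIntegral_pi_apply (hc3.intervalIntegrable _ _)]
  refine intervalIntegral.integral_congr fun u _ => ?_
  simp only [Matrix.mulVec_mulVec, ← exp_add_smul, ← sub_eq_add_neg]
  rfl

/-- If the initial covariance solves the Lyapunov equation, the Ornstein-Uhlenbeck process is
stationary, with correlations `e^{(t-s)B} C`. -/
theorem ouPath_covariance (hH : IsGaussianSpace P H) (hZ : ∀ i, (fun ω => Z₀ ω i) ∈ H)
    (hW : ∀ t, 0 ≤ t → ∀ i, (fun ω => W t ω i) ∈ H)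
    (hWc : ∀ᵐ ω ∂P, ContinuousOn (fun t => W t ω) (Ici 0)) (B : Matrix ι ι ℝ)
    {C S : Matrix ι ι ℝ} (hC : ∀ i j, ∫ ω, Z₀ ω i * Z₀ ω j ∂P = C i j)
    (hS : ∀ s t, 0 ≤ s → 0 ≤ t → ∀ i j, ∫ ω, W s ω i * W t ω j ∂P = min s t * S i j)
    (hWZ : ∀ t, 0 ≤ t → ∀ i j, ∫ ω, W t ω i * Z₀ ω j ∂P = 0) (hlyap : S = -(B * C + C * Bᵀ))
    {s t : ℝ} (hs : 0 ≤ s) (hst : s ≤ t) (i j : ι) :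
    ∫ ω, ouPath B (Z₀ ω) (fun s => W s ω) t i * ouPath B (Z₀ ω) (fun s => W s ω) s j ∂P =
      (NormedSpace.exp ((t - s) • B) * C) i j := by
  have ht := hs.trans hst
  obtain ⟨hc, he⟩ := ouPath_moment_eq hH hZ hW hWc B (ouPath_mem hH hZ hW hWc B ht i)
  have hEc : Continuous fun u : ℝ => (NormedSpace.exp ((t - u) • B) : Matrix ι ι ℝ) :=
    (continuous_exp_smul B).comp (continuous_const.sub continuous_id)
  set ρ : ℝ → ι → ℝ := fun u k => (NormedSpace.exp ((t - u) • B) * C) i k with hρ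
  have hρc : Continuous ρ := continuous_pi fun k =>
    (hEc.matrix_mul continuous_const).matrix_elem i k
  -- The later time `t` is fixed and the earlier time `u` varies, so the correlations with the
  -- initial value and with the past noise, known for `u ≤ t`, become the inhomogeneity. By the
  -- Lyapunov equation `S + C Bᵀ = -B C`, so the total integrand is the derivative of `e^{(t-v)B} C`
  -- in `v`.
  have key := volterra_unique B (a := 0) (b := t) (y₂ := ρ)
    (g := fun u => (fun k => (NormedSpace.exp (t • B) * C) i k) +
      fun k => ∫ v in (0 : ℝ)..u, (NormedSpace.exp ((t - v) • B) * S) i k)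
    (hc.mono Icc_subset_Ici_self) hρc.continuousOn (fun u hu => ?_) (fun u hu => ?_) s ⟨hs, hst⟩
  · have := congrFun key j
    simp only [hρ] at this
    rw [← this]
    simp_rw [mul_comm]
  · rw [he u hu.1]
    congr 1
    ext k
    simp only [Pi.add_apply]
    congr 1
    · rw [← ouPath_moment_init hH hZ hW hWc B hC hWZ ht]
      simp_rw [mul_comm]
    · rw [← ouPath_moment_noise hH hZ hW hWc B hS hWZ hu.1 hu.2]
      simp_rw [mul_comm]
  · ext k
    simp only [Pi.add_apply]
    have hBρ : Continuous fun v => B *ᵥ ρ v := continuous_const.matrix_mulVec hρc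
    rw [intervalIntegral_pi_apply (hBρ.intervalIntegrable _ _), add_assoc,
      ← intervalIntegral.integral_add
        (f := fun v => ((NormedSpace.exp ((t - v) • B) : Matrix ι ι ℝ) * S) i k)
        (g := fun v => (B *ᵥ ρ v) k)
        (((hEc.matrix_mul continuous_const).matrix_elem i k).intervalIntegrable _ _)
        (((continuous_apply k).comp hBρ).intervalIntegrable _ _)]
    have hint : ∀ v, (NormedSpace.exp ((t - v) • B) * S) i k + (B *ᵥ ρ v) k =
        -((NormedSpace.exp ((t - v) • B) : Matrix ι ι ℝ) * (B * C)) i k := by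
      intro v
      have h1 : (B *ᵥ ρ v) k = ((NormedSpace.exp ((t - v) • B) : Matrix ι ι ℝ) * (C * Bᵀ)) i k := by
        rw [← Matrix.mul_assoc, Matrix.mul_apply]
        simp only [Matrix.mulVec, dotProduct, hρ, Matrix.transpose_apply]
        exact Finset.sum_congr rfl fun _ _ => mul_comm _ _
      have h2 : S + C * Bᵀ = -(B * C) := by
        rw [hlyap, neg_add, neg_add_cancel_right]
      rw [h1, ← Matrix.add_apply, ← Matrix.mul_add, h2, Matrix.mul_neg, Matrix.neg_apply]
    simp_rw [hint]
    rw [intervalIntegral.integral_eq_sub_of_hasDerivAt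
      (fun v _ => hasDerivAt_exp_sub B C t v i k)
      (((hEc.matrix_mul continuous_const).matrix_elem i k).neg.intervalIntegrable _ _)]
    simp [hρ]

end OrnsteinUhlenbeck

end CoarseGrain

namespace CoarseGrain

-- Colored noise and the fluctuation-dissipation theorem.

section Noise

variable {m : ℕ}

theorem Coeffs.lyapunov (c : Coeffs m) (κ : ℝ) :
    κ • c.noiseCov = -(c.Bhat * (κ • c.Q) + (κ • c.Q) * c.Bhatᵀ) := by
  rw [Coeffs.noiseCov, Matrix.mul_smul, Matrix.smul_mul, ← smul_add, smul_neg]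

/-- The choice `Q₁₂ = C₁`, `Q₂ = C₀` makes the right block column of `Q` equal to `c.input`, so
correlation and memory share one kernel. The block `Q₁` does not enter here. -/
theorem Coeffs.exp_mul_Q (c : Coeffs m) (κ t : ℝ) (i j : Fin m) :
    (NormedSpace.exp (t • c.Bhat) * (κ • c.Q)) (Sum.inr i) (Sum.inr j) = κ * c.kernel t i j := by
  rw [Matrix.mul_smul, Matrix.smul_apply, smul_eq_mul, c.kernel_apply, Matrix.mul_apply,
    Matrix.mul_apply]
  congr 1
  refine Finset.sum_congr rfl fun a _ => ?_
  congr 1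
  rcases a with a | a <;> simp [Coeffs.Q, Coeffs.input]

variable {Ω : Type*} [MeasurableSpace Ω] {P : Measure Ω} {H : Submodule ℝ (Ω → ℝ)}
  {Z₀ : Ω → Fin m ⊕ Fin m → ℝ} {W : ℝ → Ω → Fin m ⊕ Fin m → ℝ} {W₁ : ℝ → Ω → Fin m → ℝ}

theorem coloredNoise_mem (hH : IsGaussianSpace P H) (c : Coeffs m)
    (hZ : ∀ i, (fun ω => Z₀ ω i) ∈ H) (hW : ∀ t, 0 ≤ t → ∀ i, (fun ω => W t ω i) ∈ H)
    (hWc : ∀ᵐ ω ∂P, ContinuousOn (fun t => W t ω) (Ici 0)) {t : ℝ} (ht : 0 ≤ t) (i : Fin m) :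
    (fun ω => coloredNoise c Z₀ W t ω i) ∈ H :=
  ouPath_mem hH hZ hW hWc c.Bhat ht (Sum.inr i)

theorem continuousOn_coloredNoise (c : Coeffs m)
    (hWc : ∀ᵐ ω ∂P, ContinuousOn (fun t => W t ω) (Ici 0)) :
    ∀ᵐ ω ∂P, ContinuousOn (fun t => coloredNoise c Z₀ W t ω) (Ici 0) := by
  filter_upwards [hWc] with ω hω
  exact continuousOn_pi.2 fun i =>
    continuousOn_pi.1 (continuousOn_ouPath c.Bhat (Z₀ ω) hω) (Sum.inr i)

/-- The integrated total noise lies in the Gaussian space, and its coordinates are almost surely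
the differences of the Wiener process and the integrated colored noise. -/
theorem totalNoise_mem (hH : IsGaussianSpace P H) (c : Coeffs m)
    (hZ : ∀ i, (fun ω => Z₀ ω i) ∈ H) (hW : ∀ t, 0 ≤ t → ∀ i, (fun ω => W t ω i) ∈ H)
    (hWc : ∀ᵐ ω ∂P, ContinuousOn (fun t => W t ω) (Ici 0))
    (hW₁ : ∀ t, 0 ≤ t → ∀ i, (fun ω => W₁ t ω i) ∈ H) {t : ℝ} (ht : 0 ≤ t) (i : Fin m) :
    (fun ω => ∫ s in (0 : ℝ)..t, coloredNoise c Z₀ W s ω i) ∈ H ∧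
    (∀ X ∈ H, ∫ ω, (∫ s in (0 : ℝ)..t, coloredNoise c Z₀ W s ω i) * X ω ∂P =
      ∫ s in (0 : ℝ)..t, ∫ ω, coloredNoise c Z₀ W s ω i * X ω ∂P) ∧
    (∀ᵐ ω ∂P, totalNoise c Z₀ W W₁ t ω i =
      W₁ t ω i - ∫ s in (0 : ℝ)..t, coloredNoise c Z₀ W s ω i) ∧
    (fun ω => totalNoise c Z₀ W W₁ t ω i) ∈ H := by
  have hgc := continuousOn_coloredNoise (Z₀ := Z₀) c hWc
  have hI := hH.integral_mem (X := fun s ω => coloredNoise c Z₀ W s ω i) ht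
    (fun s hs => coloredNoise_mem hH c hZ hW hWc hs.1 i) (by
      filter_upwards [hgc] with ω hω
      exact (continuousOn_pi.1 hω i).mono Icc_subset_Ici_self)
  have hae : ∀ᵐ ω ∂P, totalNoise c Z₀ W W₁ t ω i =
      W₁ t ω i - ∫ s in (0 : ℝ)..t, coloredNoise c Z₀ W s ω i := by
    filter_upwards [hgc] with ω hω
    rw [totalNoise, Pi.sub_apply,
      intervalIntegral_pi_apply (ContinuousOn.intervalIntegrable_of_nonneg hω ht)]
  refine ⟨hI.1, hI.2, hae, hH.congr_ae (H.sub_mem (hW₁ t ht i) hI.1) ?_⟩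
  filter_upwards [hae] with ω hω
  rw [hω]
  rfl

/-- The correlation with `X` solves a homogeneous Volterra equation with zero data, hence vanishes;
independence need not be extended to time integrals. -/
theorem coloredNoise_mul_of_uncorrelated (hH : IsGaussianSpace P H) (c : Coeffs m)
    (hZ : ∀ i, (fun ω => Z₀ ω i) ∈ H) (hW : ∀ t, 0 ≤ t → ∀ i, (fun ω => W t ω i) ∈ H)
    (hWc : ∀ᵐ ω ∂P, ContinuousOn (fun t => W t ω) (Ici 0)) {X : Ω → ℝ} (hX : X ∈ H)
    (hZX : ∀ i, ∫ ω, Z₀ ω i * X ω ∂P = 0) (hWX : ∀ t, 0 ≤ t → ∀ i, ∫ ω, W t ω i * X ω ∂P = 0)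
    {t : ℝ} (ht : 0 ≤ t) (i : Fin m) : ∫ ω, coloredNoise c Z₀ W t ω i * X ω ∂P = 0 := by
  obtain ⟨hc, he⟩ := ouPath_moment_eq hH hZ hW hWc c.Bhat hX
  have := volterra_unique c.Bhat (g := fun _ => 0) (y₂ := fun _ => 0)
    (hc.mono Icc_subset_Ici_self) continuousOn_const (fun s hs => (he s hs.1).trans (by
      congr 1
      ext k
      simp only [Pi.add_apply, hZX, hWX s hs.1, add_zero, Pi.zero_apply]))
    (fun s _ => by simp) t ⟨ht, le_rfl⟩
  exact congrFun this (Sum.inr i)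

theorem extend_of_le {K : ℝ → Matrix (Fin m) (Fin m) ℝ} {u v : ℝ} (h : v ≤ u) :
    extend K (u - v) = K (u - v) := if_pos (sub_nonneg.2 h)

theorem extend_of_lt {K : ℝ → Matrix (Fin m) (Fin m) ℝ} {u v : ℝ} (h : u < v) :
    extend K (u - v) = (K (v - u))ᵀ := by
  rw [extend, if_neg (not_le.2 (sub_neg.2 h)), neg_sub]

/-- The second fluctuation-dissipation theorem for the integrated total noise. -/
theorem secondFDT_totalNoise (hH : IsGaussianSpace P H) (c : Coeffs m) {κ : ℝ}
    {Γ : Matrix (Fin m) (Fin m) ℝ}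
    (hZ : ∀ i, (fun ω => Z₀ ω i) ∈ H) (hW : ∀ t, 0 ≤ t → ∀ i, (fun ω => W t ω i) ∈ H)
    (hWc : ∀ᵐ ω ∂P, ContinuousOn (fun t => W t ω) (Ici 0))
    (hW₁ : ∀ t, 0 ≤ t → ∀ i, (fun ω => W₁ t ω i) ∈ H)
    (hΓ : ∀ s t, 0 ≤ s → 0 ≤ t → ∀ i j,
      ∫ ω, W₁ s ω i * W₁ t ω j ∂P = min s t * ((2 * κ) • Γ) i j)
    (hZW₁ : ∀ t, 0 ≤ t → ∀ i j, ∫ ω, Z₀ ω i * W₁ t ω j ∂P = 0)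
    (hWW₁ : ∀ s t, 0 ≤ s → 0 ≤ t → ∀ i j, ∫ ω, W s ω i * W₁ t ω j ∂P = 0)
    (hg : ∀ s t, 0 ≤ s → s ≤ t → ∀ i j,
      ∫ ω, coloredNoise c Z₀ W t ω i * coloredNoise c Z₀ W s ω j ∂P = κ * c.kernel (t - s) i j) :
    SecondFDT P κ Γ c.kernel (totalNoise c Z₀ W W₁) := by
  intro s t hs ht i j
  obtain ⟨hIs, hIsX, haes, hns⟩ := totalNoise_mem hH c hZ hW hWc hW₁ hs i
  obtain ⟨hIt, hItX, haet, hnt⟩ := totalNoise_mem hH c hZ hW hWc hW₁ ht j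
  refine ⟨hH.integrable_mul hns hnt, ?_⟩
  have hcross : ∀ a b, 0 ≤ a → 0 ≤ b → ∀ k l,
      ∫ ω, coloredNoise c Z₀ W a ω k * W₁ b ω l ∂P = 0 := fun a b ha hb k l =>
    coloredNoise_mul_of_uncorrelated hH c hZ hW hWc (hW₁ b hb l) (fun i => hZW₁ b hb i l)
      (fun t ht i => hWW₁ t b ht hb i l) ha k
  have hgg : ∀ u v, 0 ≤ u → 0 ≤ v →
      ∫ ω, coloredNoise c Z₀ W u ω i * coloredNoise c Z₀ W v ω j ∂P =
        κ * extend c.kernel (u - v) i j := by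
    intro u v hu hv
    rcases le_or_gt v u with h | h
    · rw [extend_of_le h, hg v u hv h]
    · rw [extend_of_lt h, Matrix.transpose_apply, ← hg u v hu h.le]
      simp_rw [mul_comm]
  -- The expectation is moved through the two time integrals one at a time, the other factor being a
  -- fixed element of `H`.
  have hII : ∫ ω, (∫ u in (0 : ℝ)..s, coloredNoise c Z₀ W u ω i) *
      (∫ v in (0 : ℝ)..t, coloredNoise c Z₀ W v ω j) ∂P =
      κ * ∫ u in (0 : ℝ)..s, ∫ v in (0 : ℝ)..t, extend c.kernel (u - v) i j := by
    rw [hIsX _ hIt, ← intervalIntegral.integral_const_mul]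
    refine intervalIntegral.integral_congr fun u hu => ?_
    rw [uIcc_of_le hs] at hu
    rw [← intervalIntegral.integral_const_mul]
    simp_rw [mul_comm (coloredNoise c Z₀ W u _ i)]
    rw [hItX _ (coloredNoise_mem hH c hZ hW hWc hu.1 i)]
    refine intervalIntegral.integral_congr fun v hv => ?_
    rw [uIcc_of_le ht] at hv
    rw [← hgg u v hu.1 hv.1]
    simp_rw [mul_comm]
  have hIW : ∫ ω, (∫ u in (0 : ℝ)..s, coloredNoise c Z₀ W u ω i) * W₁ t ω j ∂P = 0 := by
    rw [hIsX _ (hW₁ t ht j)]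
    refine (intervalIntegral.integral_congr fun u hu => ?_).trans intervalIntegral.integral_zero
    rw [uIcc_of_le hs] at hu
    exact hcross u t hu.1 ht i j
  have hWI : ∫ ω, W₁ s ω i * (∫ v in (0 : ℝ)..t, coloredNoise c Z₀ W v ω j) ∂P = 0 := by
    simp_rw [mul_comm (W₁ s _ i)]
    rw [hItX _ (hW₁ s hs i)]
    refine (intervalIntegral.integral_congr fun u hu => ?_).trans intervalIntegral.integral_zero
    rw [uIcc_of_le ht] at hu
    exact hcross u s hu.1 hs j i
  -- The mixed terms have expectation zero, so the minus sign in `f₁ - g` leaves the covariance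
  -- unaffected.
  have hexp : ∀ᵐ ω ∂P, totalNoise c Z₀ W W₁ s ω i * totalNoise c Z₀ W W₁ t ω j =
      W₁ s ω i * W₁ t ω j - W₁ s ω i * (∫ v in (0 : ℝ)..t, coloredNoise c Z₀ W v ω j) -
        ((∫ u in (0 : ℝ)..s, coloredNoise c Z₀ W u ω i) * W₁ t ω j -
          (∫ u in (0 : ℝ)..s, coloredNoise c Z₀ W u ω i) *
            (∫ v in (0 : ℝ)..t, coloredNoise c Z₀ W v ω j)) := by
    filter_upwards [haes, haet] with ω h1 h2
    rw [h1, h2]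
    ring
  have i1 := hH.integrable_mul (hW₁ s hs i) (hW₁ t ht j)
  have i2 := hH.integrable_mul (hW₁ s hs i) hIt
  have i3 := hH.integrable_mul hIs (hW₁ t ht j)
  have i4 := hH.integrable_mul hIs hIt
  have i12 : Integrable (fun ω => W₁ s ω i * W₁ t ω j -
      W₁ s ω i * (∫ v in (0 : ℝ)..t, coloredNoise c Z₀ W v ω j)) P := i1.sub i2
  have i34 : Integrable (fun ω => (∫ u in (0 : ℝ)..s, coloredNoise c Z₀ W u ω i) * W₁ t ω j -
      (∫ u in (0 : ℝ)..s, coloredNoise c Z₀ W u ω i) *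
        (∫ v in (0 : ℝ)..t, coloredNoise c Z₀ W v ω j)) P := i3.sub i4
  rw [integral_congr_ae hexp, integral_sub i12 i34, integral_sub i1 i2,
    integral_sub i3 i4, hΓ s t hs ht, hWI, hIW, hII, Matrix.smul_apply, smul_eq_mul]
  ring

end Noise

end CoarseGrain

-- Assembly of the theorem.

theorem theorem2 {N m : ℕ} (M : CoarseGrain.LangevinModel N m)
    (hθ : ∀ i j, IntegrableOn (fun t => M.kernel t i j) (Ioi 0))
    (c : CoarseGrain.Coeffs m) (hc : c.MomentMatching M.kernel)
    (kB T : ℝ) (hkB : 0 < kB) (hT : 0 < T)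
    {Ω : Type*} [MeasurableSpace Ω] (P : Measure Ω) [IsProbabilityMeasure P]
    (Z₀ : Ω → Fin m ⊕ Fin m → ℝ) (W : ℝ → Ω → (Fin m ⊕ Fin m → ℝ)) (W₁ : ℝ → Ω → (Fin m → ℝ))
    -- the initial values `(z₁(0), z(0))`
    (hZ₀ : CoarseGrain.IsCenteredGaussian P ((kB * T) • c.Q) Z₀)
    -- the white noise `(ζ₁, ζ)`
    (hW : CoarseGrain.IsWiener P ((kB * T) • c.noiseCov) W)
    -- the white noise `f₁`
    (hW₁ : CoarseGrain.IsWiener P ((2 * (kB * T)) • M.Γ11) W₁)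
    (hind : IndepFun Z₀ (fun ω (t : ℝ≥0) => W t ω) P)
    (hind₁ : IndepFun (fun ω => (Z₀ ω, fun t : ℝ≥0 => W t ω)) (fun ω (t : ℝ≥0) => W₁ t ω) P) :
    -- the moment equations
    (c.C0 = M.kernelDeriv 0 ∧
      c.C1 + c.B0 * c.C0 = M.kernelDeriv 1 ∧
      c.B0 * M.kernelDeriv 1 + c.B1 * c.C0 = M.kernelDeriv 2 ∧
      c.C1 = -(c.B1 * M.kernelIntegral)) ∧
    -- the rational function is the Laplace transform of the approximate kernel
    (∀ᶠ lam in 𝓝[>] (0 : ℝ),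
      (∀ i j, IntegrableOn (fun t => c.kernel t i j * Real.exp (-t / lam)) (Ioi 0)) ∧
      CoarseGrain.laplace c.kernel lam = c.R22 lam) ∧
    -- the second-order model is equivalent to the GLE with the approximate kernel and noise
    (∀ᵐ ω ∂P, ∀ q p : ℝ → Fin m → ℝ,
      ((∃ z₁ z : ℝ → Fin m → ℝ,
          z₁ 0 = (fun i => Z₀ ω (Sum.inl i)) ∧ z 0 = (fun i => Z₀ ω (Sum.inr i)) ∧
          CoarseGrain.SolvesSecondOrder M c (fun t => W₁ t ω) (fun t => W t ω) q p z₁ z) ↔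
        CoarseGrain.SolvesGLE M c.kernel
          (fun t => CoarseGrain.totalNoise c Z₀ W W₁ t ω) q p) ∧
      ∀ z₁ z : ℝ → Fin m → ℝ,
        z₁ 0 = (fun i => Z₀ ω (Sum.inl i)) → z 0 = (fun i => Z₀ ω (Sum.inr i)) →
        CoarseGrain.SolvesSecondOrder M c (fun t => W₁ t ω) (fun t => W t ω) q p z₁ z →
        ∀ t, 0 ≤ t →
          z t = CoarseGrain.memory c.kernel p t + CoarseGrain.coloredNoise c Z₀ W t ω) ∧
    -- the colored noise is a centered stationary Gaussian process ...
    IsGaussianProcess (fun t : ℝ≥0 => CoarseGrain.coloredNoise c Z₀ W t) P ∧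
    (∀ t, 0 ≤ t → ∀ i, ∫ ω, CoarseGrain.coloredNoise c Z₀ W t ω i ∂P = 0) ∧
    (∀ (k : ℕ) (t : Fin k → ℝ) (h : ℝ), (∀ a, 0 ≤ t a) → 0 ≤ h →
      P.map (fun ω a => CoarseGrain.coloredNoise c Z₀ W (t a + h) ω) =
        P.map (fun ω a => CoarseGrain.coloredNoise c Z₀ W (t a) ω)) ∧
    -- ... whose time correlation is `k_B T` times the approximate kernel
    (∀ t t', 0 ≤ t' → t' ≤ t → ∀ i j,
      ∫ ω, CoarseGrain.coloredNoise c Z₀ W t ω i * CoarseGrain.coloredNoise c Z₀ W t' ω j ∂P =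
        kB * T * c.kernel (t - t') i j) ∧
    -- the total noise is centered Gaussian and satisfies the second FDT
    IsGaussianProcess (fun t : ℝ≥0 => CoarseGrain.totalNoise c Z₀ W W₁ t) P ∧
    (∀ t, 0 ≤ t → ∀ i, ∫ ω, CoarseGrain.totalNoise c Z₀ W W₁ t ω i ∂P = 0) ∧
    CoarseGrain.SecondFDT P (kB * T) M.Γ11 c.kernel
      (CoarseGrain.totalNoise c Z₀ W W₁) := by
  obtain ⟨H, hH, mZ, mW, mW₁, hWZ, hZW₁, hWW₁⟩ :=
    CoarseGrain.exists_gaussianSpace_of_indep hZ₀ hW hW₁ hind hind₁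
  have hcov : ∀ t t', 0 ≤ t' → t' ≤ t → ∀ i j,
      ∫ ω, CoarseGrain.coloredNoise c Z₀ W t ω i * CoarseGrain.coloredNoise c Z₀ W t' ω j ∂P =
        kB * T * c.kernel (t - t') i j := by
    intro t t' ht' htt' i j
    rw [← c.exp_mul_Q]
    exact CoarseGrain.ouPath_covariance hH mZ mW hW.cont c.Bhat hZ₀.cov hW.cov hWZ
      (c.lyapunov (kB * T)) ht' htt' (Sum.inr i) (Sum.inr j)
  have hmem : ∀ t, 0 ≤ t → ∀ i, (fun ω => CoarseGrain.coloredNoise c Z₀ W t ω i) ∈ H :=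
    fun t ht i => CoarseGrain.coloredNoise_mem hH c mZ mW hW.cont ht i
  have hmem' : ∀ t, 0 ≤ t → ∀ i, (fun ω => CoarseGrain.totalNoise c Z₀ W W₁ t ω i) ∈ H :=
    fun t ht i => (CoarseGrain.totalNoise_mem hH c mZ mW hW.cont mW₁ ht i).2.2.2
  refine ⟨⟨?_, ?_, ?_, ?_⟩, c.laplace_kernel, ?_, hH.isGaussianProcess fun t i => hmem t t.2 i,
    fun t ht i => hH.mean _ (hmem t ht i), ?_, hcov,
    hH.isGaussianProcess fun t i => hmem' t t.2 i, fun t ht i => hH.mean _ (hmem' t ht i),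
    CoarseGrain.secondFDT_totalNoise hH c mZ mW hW.cont mW₁ hW₁.cov hZW₁ hWW₁
      fun s t hs hst => hcov t s hs hst⟩
  · have h := hc.at_zero
    rw [M.kernel_eq] at h
    simpa [M.kernelDeriv_eq] using (c.moments_at_zero _ _ _ h).1
  · have h := hc.at_zero
    rw [M.kernel_eq] at h
    have h1 := c.moments_at_zero _ _ _ h
    rw [M.kernelDeriv_eq, pow_one, ← h1.2.1, ← h1.1]
  · have h := hc.at_zero
    rw [M.kernel_eq] at h
    have h1 := c.moments_at_zero _ _ _ h
    rw [M.kernelDeriv_eq, M.kernelDeriv_eq, pow_one, ← h1.2.2, ← h1.1]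
  · exact c.moment_at_infty hθ hc.at_infty
  · filter_upwards [hW.cont, hW.zero] with ω hω hω0 q p
    refine ⟨CoarseGrain.exists_solvesSecondOrder_iff M c hω hω0 (Z₀ ω) q p, ?_⟩
    intro z₁ z h₁ h₀ h t ht
    rw [h.z_eq hω ht, h₁, h₀]
    have : Sum.elim (fun i => Z₀ ω (Sum.inl i)) (fun i => Z₀ ω (Sum.inr i)) = Z₀ ω := by
      ext (i | i) <;> rfl
    rw [this]
    rfl
  · intro k t h ht hh
    refine hH.map_eq_map (X := fun a i ω => CoarseGrain.coloredNoise c Z₀ W (t a + h) ω i)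
      (Y := fun a i ω => CoarseGrain.coloredNoise c Z₀ W (t a) ω i)
      (fun a i => hmem _ (add_nonneg (ht a) hh) i) (fun a i => hmem _ (ht a) i) ?_
    intro a i b j
    -- The covariance formula needs the later time in the first factor; in either order it depends
    -- only on the time difference, which the shift by `h` preserves.
    rcases le_total (t b) (t a) with hab | hab
    · rw [hcov _ _ (add_nonneg (ht b) hh) (by linarith), hcov _ _ (ht b) hab,
        add_sub_add_right_eq_sub]
    · simp_rw [mul_comm _ (CoarseGrain.coloredNoise c Z₀ W _ _ j)]
      rw [hcov _ _ (add_nonneg (ht a) hh) (by linarith), hcov _ _ (ht a) hab,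
        add_sub_add_right_eq_sub]
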